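/- Let $G=(V,E)$ be a (simple) graph, regarded as a 1-complex in which every edge is a copy of $[0,1]$, and let $\ell:E\to\mathbb R_{>0}$ satisfy $\sum_{e\in E}\ell(e)<\infty$. **The space $|G|_\ell$.** Scale every edge $e$ to length $\ell(e)$, and for points $x,y$ of the 1-complex $G$ let $d_\ell(x,y)\in[0,\infty]$ be the infimum of the lengths of the arcs in $G$ from $x$ to $y$, the length of an arc being the sum of the lengths of the edges and maximal half-edges in it (so $d_\ell(x,y)=\infty$ if $x$ and $y$ lie in different components of $G$). Identify points at distance $0$; $|G|_\ell$ is the completion of the resulting (extended) metric space. **The space $\mathrm{ETOP}(G)$.** A ray is a one-way infinite path. Two rays are edge-equivalent if for every finite $S\subseteq E$ they have tails in the same component of $G-S$; the classes are the edge-ends of $G$. Let $\mathrm{ETOP}'(G)$ be the set of all points of the 1-complex $G$ and all edge-ends, with the topology generated by the open subsets of the interiors of edges together with all sets $C\cup\Omega'(C)\cup E'(C)$, where $S\subseteq E$ is finite, $C$ is a component of $G-S$, $\Omega'(C)$ is the set of edge-ends having a ray in $C$, and $E'(C)$ is a union of half-edges $(z,y]$ with $z$ an inner point of $e$, one for every edge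 $e\in S$ and every endvertex $y$ of $e$ in $C$. $\mathrm{ETOP}(G)$ is the quotient of $\mathrm{ETOP}'(G)$ obtained by identifying points that have the same open neighbourhoods. **The space $|G|$.** Two rays are vertex-equivalent if for every finite $S\subseteq V$ they have tails in the same component of $G-S$; the classes are the ends of $G$. For locally finite $G$, the Freudenthal compactification $|G|$ is the set of all points of the 1-complex $G$ and all ends, with the topology generated by the open subsets of the interiors of edges, the open stars around vertices (a vertex $v$ together with a half-edge $[v,z)$ of each edge at $v$), and all sets $C\cup\Omega(C)\cup E'(C)$, where $S\subseteq V$ is finite, $C$ is a component of $G-S$, $\Omega(C)$ is the set of ends having a ray in $C$, and $E'(C)$ is a union of half-edges $(z,y]$, one for every edge $xy$ with $x\in S$ and $y\in C$. **Theorem.** 1. If $G$ is countable, then there is a homeomorphism $|G|_\ell\to\mathrm{ETOP}(G)$ that extends the identity on $G$, i.e. for every point $x$ of the 1-complex $G$ it maps the canonical image of $x$ in $|G|_\ell$ to the canonical image of $x$ in $\mathrm{ETOP}(G)$. 2. If $G$ is locally finite, then there is a homeomorphism from $|G|_\ell$ to the Freudenthal compactification $|G|$ that extends the identity on $G$. 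-/

import Mathlib

open scoped NNReal ENNReal

namespace GraphSpace

universe u

variable {V : Type u}

/-! ### The 1-complex of a graph -/

section Complex

variable (G : SimpleGraph V)

/-- First endvertex of an edge, in an arbitrarily fixed orientation. -/
noncomputable def src {G : SimpleGraph V} (e : G.edgeSet) : V := (Quot.out (e : Sym2 V)).1

/-- Second endvertex of an edge, in an arbitrarily fixed orientation. -/
noncomputable def tgt {G : SimpleGraph V} (e : G.edgeSet) : V := (Quot.out (e : Sym2 V)).2

theorem mk_src_tgt {G : SimpleGraph V} (e : G.edgeSet) : s(src e, tgt e) = (e : Sym2 V) :=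
  Quot.out_eq (e : Sym2 V)

theorem adj_src_tgt {G : SimpleGraph V} (e : G.edgeSet) : G.Adj (src e) (tgt e) := by
  rw [← SimpleGraph.mem_edgeSet, mk_src_tgt]
  exact e.2

/-- The points of the graph `G`, considered as a 1-complex: its vertices, and the inner points of
its edges, each edge `e` being a copy of `[0, 1]` that runs from `src e` to `tgt e`. -/
inductive OneComplex : Type u
  | vertex (v : V) : OneComplex
  | inner (e : G.edgeSet) (t : Set.Ioo (0 : ℝ) 1) : OneComplex

end Complex

/-! ### The distance induced by edge lengths, and the completion -/

section Metric

variable {G : SimpleGraph V} (ℓ : G.edgeSet → ℝ≥0)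

/-- The length of a walk: the sum of the lengths of the edges it traverses. -/
def walkLength {v w : V} (p : G.Walk v w) : ℝ :=
  (p.darts.map fun d => (ℓ ⟨d.edge, d.edge_mem⟩ : ℝ)).sum

/-- `HalfEdgeLength ℓ x v r`: the point `x` is joined to the vertex `v` by a (possibly trivial)
half-edge of length `r`. Each edge `e` is scaled linearly to length `ℓ e`. -/
inductive HalfEdgeLength : OneComplex G → V → ℝ → Prop
  | vertex (v : V) : HalfEdgeLength (.vertex v) v 0
  | src (e : G.edgeSet) (t : Set.Ioo (0 : ℝ) 1) :
      HalfEdgeLength (.inner e t) (src e) (ℓ e * (t : ℝ))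
  | tgt (e : G.edgeSet) (t : Set.Ioo (0 : ℝ) 1) :
      HalfEdgeLength (.inner e t) (tgt e) (ℓ e * (1 - (t : ℝ)))

/-- The lengths of the arcs between two points of the 1-complex. An arc either is a segment of a
single edge, or it consists of a half-edge from `x` to a vertex `v`, a `v`-`w` path, and a half-edge
from `w` to `y`. (In the second case the three pieces are not required to be internally disjoint:
where they overlap, removing the overlap leaves an arc that is at most as long, so that the infimum
of the lengths is not affected.) -/
inductive ArcLength : OneComplex G → OneComplex G → ℝ → Prop
  | segment (e : G.edgeSet) (s t : Set.Ioo (0 : ℝ) 1) :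
      ArcLength (.inner e s) (.inner e t) (ℓ e * |(s : ℝ) - t|)
  | through {x y : OneComplex G} {v w : V} {a b : ℝ} (p : G.Walk v w) (hp : p.IsPath)
      (hx : HalfEdgeLength ℓ x v a) (hy : HalfEdgeLength ℓ y w b) :
      ArcLength x y (a + walkLength ℓ p + b)

/-- The distance `d_ℓ`: the infimum of the lengths of the arcs between two points. It is `∞` when
there is no such arc, that is, between distinct components of `G`. -/
noncomputable def lengthDist (x y : OneComplex G) : ℝ≥0∞ :=
  ⨅ (r : ℝ) (_ : ArcLength ℓ x y r), ENNReal.ofReal r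

theorem walkLength_nonneg {v w : V} (p : G.Walk v w) : 0 ≤ walkLength ℓ p := by
  unfold walkLength
  refine List.sum_nonneg fun r hr => ?_
  obtain ⟨d, -, rfl⟩ := List.mem_map.1 hr
  exact NNReal.coe_nonneg _

theorem walkLength_cons {u v w : V} (h : G.Adj u v) (p : G.Walk v w) :
    walkLength ℓ (p.cons h) = ℓ ⟨s(u, v), h⟩ + walkLength ℓ p := by
  simp [walkLength, SimpleGraph.Dart.edge]

theorem walkLength_append {u v w : V} (p : G.Walk u v) (q : G.Walk v w) :
    walkLength ℓ (p.append q) = walkLength ℓ p + walkLength ℓ q := by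
  simp [walkLength]

theorem walkLength_reverse {v w : V} (p : G.Walk v w) :
    walkLength ℓ p.reverse = walkLength ℓ p := by
  induction p with
  | nil => rfl
  | cons h p ih =>
    rw [SimpleGraph.Walk.reverse_cons, walkLength_append, ih, walkLength_cons, walkLength_cons,
      add_comm]
    congr 1
    simp [walkLength, Sym2.eq_swap]

theorem exists_path_le {v w : V} (p : G.Walk v w) :
    ∃ q : G.Walk v w, q.IsPath ∧ walkLength ℓ q ≤ walkLength ℓ p := by
  classical
  induction p with
  | nil => exact ⟨.nil, .nil, le_rfl⟩
  | @cons u v w h p ih =>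
    obtain ⟨q, hq, hle⟩ := ih
    by_cases hu : u ∈ q.support
    · refine ⟨q.dropUntil u hu, hq.dropUntil hu, ?_⟩
      have h1 : walkLength ℓ q
          = walkLength ℓ (q.takeUntil u hu) + walkLength ℓ (q.dropUntil u hu) := by
        rw [← walkLength_append, SimpleGraph.Walk.take_spec]
      have h2 := walkLength_nonneg ℓ (q.takeUntil u hu)
      have h3 := (ℓ ⟨s(u, v), h⟩).coe_nonneg
      rw [walkLength_cons]
      linarith
    · refine ⟨q.cons h, hq.cons hu, ?_⟩
      rw [walkLength_cons, walkLength_cons]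
      linarith

theorem HalfEdgeLength.nonneg {x : OneComplex G} {v : V} {a : ℝ} (h : HalfEdgeLength ℓ x v a) :
    0 ≤ a := by
  cases h with
  | vertex => exact le_rfl
  | src e t => exact mul_nonneg (ℓ e).coe_nonneg t.2.1.le
  | tgt e t => exact mul_nonneg (ℓ e).coe_nonneg (sub_nonneg.2 t.2.2.le)

theorem ArcLength.nonneg {x y : OneComplex G} {r : ℝ} (h : ArcLength ℓ x y r) : 0 ≤ r := by
  cases h with
  | segment e s t => positivity
  | through p hp hx hy =>
    have h1 := hx.nonneg
    have h2 := hy.nonneg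
    have h3 := walkLength_nonneg ℓ p
    linarith

theorem ArcLength.symm {x y : OneComplex G} {r : ℝ} (h : ArcLength ℓ x y r) :
    ArcLength ℓ y x r := by
  cases h with
  | segment e s t => rw [abs_sub_comm]; exact .segment e t s
  | @through _ _ _ _ a b p hp hx hy =>
    have := ArcLength.through p.reverse hp.reverse hy hx
    rw [walkLength_reverse] at this
    convert this using 1
    ring

theorem exists_halfEdge_le (e : G.edgeSet) (s t : Set.Ioo (0 : ℝ) 1) {v : V} {a : ℝ}
    (h : HalfEdgeLength ℓ (.inner e t) v a) :
    ∃ a', HalfEdgeLength ℓ (.inner e s) v a' ∧ a' ≤ ℓ e * |(s : ℝ) - t| + a := by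
  have hl := (ℓ e).coe_nonneg
  have h1 := le_abs_self ((s : ℝ) - t)
  have h2 := neg_abs_le ((s : ℝ) - t)
  cases h with
  | src => exact ⟨_, .src e s, by nlinarith⟩
  | tgt => exact ⟨_, .tgt e s, by nlinarith⟩

/-- The two ends of an edge, via a point of the edge. -/
theorem exists_walk_le {y : OneComplex G} {v w : V} {a b : ℝ} (ha : HalfEdgeLength ℓ y v a)
    (hb : HalfEdgeLength ℓ y w b) : ∃ p : G.Walk v w, walkLength ℓ p ≤ a + b := by
  have hn := add_nonneg ha.nonneg hb.nonneg
  have key : ∀ e : G.edgeSet, walkLength ℓ ((adj_src_tgt e).toWalk) = ℓ e := by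
    intro e
    have he : (⟨s(src e, tgt e), adj_src_tgt e⟩ : G.edgeSet) = e := Subtype.ext (mk_src_tgt e)
    have hc := walkLength_cons ℓ (adj_src_tgt e) (.nil : G.Walk (tgt e) (tgt e))
    rw [he] at hc
    refine hc.trans ?_
    simp [walkLength]
  cases ha with
  | vertex => cases hb; exact ⟨.nil, by simp [walkLength]⟩
  | src e t =>
    cases hb with
    | src => exact ⟨.nil, by simpa [walkLength] using hn⟩
    | tgt => exact ⟨_, by rw [key e]; linarith⟩
  | tgt e t =>
    cases hb with
    | tgt => exact ⟨.nil, by simpa [walkLength] using hn⟩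
    | src =>
      refine ⟨(adj_src_tgt e).toWalk.reverse, ?_⟩
      rw [walkLength_reverse, key e]
      linarith

theorem exists_arc_le {x y z : OneComplex G} {r s : ℝ} (hr : ArcLength ℓ x y r)
    (hs : ArcLength ℓ y z s) : ∃ c, ArcLength ℓ x z c ∧ c ≤ r + s := by
  cases hr with
  | segment e s₁ s₂ =>
    cases hs with
    | segment _ _ s₃ =>
      refine ⟨_, .segment e s₁ s₃, ?_⟩
      rw [← mul_add]
      exact mul_le_mul_of_nonneg_left (abs_sub_le _ _ _) (ℓ e).coe_nonneg
    | through p hp hx hy =>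
      obtain ⟨a', ha', hle⟩ := exists_halfEdge_le ℓ e s₁ s₂ hx
      exact ⟨_, .through p hp ha' hy, by linarith⟩
  | through p hp hx hy =>
    cases hs with
    | segment e s₂ s₃ =>
      obtain ⟨a', ha', hle⟩ := exists_halfEdge_le ℓ e s₃ s₂ hy
      rw [abs_sub_comm] at hle
      exact ⟨_, .through p hp hx ha', by linarith⟩
    | through q hq hy' hz =>
      obtain ⟨m, hm⟩ := exists_walk_le ℓ hy hy'
      obtain ⟨c, hc, hle⟩ := exists_path_le ℓ ((p.append m).append q)
      refine ⟨_, .through c hc hx hz, ?_⟩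
      rw [walkLength_append, walkLength_append] at hle
      linarith

theorem lengthDist_self (x : OneComplex G) : lengthDist ℓ x x = 0 := by
  refine le_antisymm ?_ zero_le
  cases x with
  | vertex v =>
    refine (iInf₂_le _ (ArcLength.through .nil .nil (.vertex v) (.vertex v))).trans ?_
    simp [walkLength]
  | inner e t =>
    refine (iInf₂_le _ (ArcLength.segment e t t)).trans ?_
    simp

theorem lengthDist_comm (x y : OneComplex G) : lengthDist ℓ x y = lengthDist ℓ y x :=
  le_antisymm (le_iInf₂ fun r hr => iInf₂_le r hr.symm) (le_iInf₂ fun r hr => iInf₂_le r hr.symm)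

theorem lengthDist_triangle (x y z : OneComplex G) :
    lengthDist ℓ x z ≤ lengthDist ℓ x y + lengthDist ℓ y z := by
  unfold lengthDist
  simp only [ENNReal.iInf_add, ENNReal.add_iInf]
  refine le_iInf₂ fun r hr => le_iInf₂ fun s hs => ?_
  obtain ⟨c, hc, hle⟩ := exists_arc_le ℓ hs hr
  refine (iInf₂_le c hc).trans ?_
  rw [← ENNReal.ofReal_add hs.nonneg hr.nonneg]
  exact ENNReal.ofReal_le_ofReal hle

/-- The 1-complex `G` with the (extended) pseudometric `d_ℓ`. -/
def LengthSpace (_ : G.edgeSet → ℝ≥0) : Type u := OneComplex G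

noncomputable instance : PseudoEMetricSpace (LengthSpace ℓ) where
  edist x y := lengthDist ℓ x y
  edist_self := lengthDist_self ℓ
  edist_comm := lengthDist_comm ℓ
  edist_triangle := lengthDist_triangle ℓ

/-- The (extended) metric space obtained from `G` by identifying points at distance `0`; for
positive `ℓ` only vertices are identified. -/
abbrev IdSpace (ℓ : G.edgeSet → ℝ≥0) : Type u := SeparationQuotient (LengthSpace ℓ)

/-- The space `|G|_ℓ`, the completion of the metric space `(IdSpace ℓ, d_ℓ)`. -/
abbrev LTop (ℓ : G.edgeSet → ℝ≥0) : Type u := UniformSpace.Completion (IdSpace ℓ)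

/-- The canonical map from the 1-complex `G` to `|G|_ℓ`. -/
noncomputable def toLTop (x : OneComplex G) : LTop ℓ :=
  ((SeparationQuotient.mk (show LengthSpace ℓ from x) : IdSpace ℓ) : LTop ℓ)

end Metric

/-! ### Rays and ends -/

section Ends

open Filter

variable (G : SimpleGraph V)

/-- A ray: a one-way infinite path. -/
structure Ray where
  toFun : ℕ → V
  injective : Function.Injective toFun
  adj : ∀ n, G.Adj (toFun n) (toFun (n + 1))

variable {G}

theorem ray_eventually {H : SimpleGraph V} (f : ℕ → V)
    (h : ∀ᶠ n in atTop, H.Adj (f n) (f (n + 1))) :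
    ∃ C : H.ConnectedComponent, ∀ᶠ n in atTop, f n ∈ C.supp := by
  obtain ⟨N, hN⟩ := eventually_atTop.1 h
  refine ⟨H.connectedComponentMk (f N), eventually_atTop.2 ⟨N, fun n hn => ?_⟩⟩
  induction n, hn using Nat.le_induction with
  | base => rfl
  | succ n hn ih =>
    rw [SimpleGraph.ConnectedComponent.mem_supp_iff] at ih ⊢
    rw [← ih]
    exact SimpleGraph.ConnectedComponent.sound (hN n hn).symm.reachable

/-- Two rays are edge-equivalent if no finite set `S` of edges separates them, that is, if they
have tails in the same component of `G - S`. -/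
def EdgeEquiv (R L : Ray G) : Prop :=
  ∀ S : Set (Sym2 V), S.Finite → S ⊆ G.edgeSet →
    ∃ C : (G.deleteEdges S).ConnectedComponent,
      (∀ᶠ n in atTop, R.toFun n ∈ C.supp) ∧ ∀ᶠ n in atTop, L.toFun n ∈ C.supp

/-- Two rays are vertex-equivalent if no finite set `S` of vertices separates them, that is, if they
have tails in the same component of `G - S`. -/
def VertexEquiv (R L : Ray G) : Prop :=
  ∀ S : Set V, S.Finite →
    ∃ C : G.ComponentCompl S,
      (∀ᶠ n in atTop, R.toFun n ∈ C) ∧ ∀ᶠ n in atTop, L.toFun n ∈ C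

theorem EdgeEquiv.refl (R : Ray G) : EdgeEquiv R R := by
  intro S hS _
  have hinj : Function.Injective fun n => s(R.toFun n, R.toFun (n + 1)) := by
    intro m n hmn
    rcases Sym2.eq_iff.1 hmn with ⟨h, -⟩ | ⟨h1, h2⟩
    · exact R.injective h
    · have h1 := R.injective h1
      have h2 := R.injective h2
      omega
  have hev : ∀ᶠ n in atTop, (G.deleteEdges S).Adj (R.toFun n) (R.toFun (n + 1)) := by
    have hfin := hS.preimage (hinj.injOn (s := _))
    rw [← Nat.cofinite_eq_atTop]
    filter_upwards [hfin.compl_mem_cofinite] with n hn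
    exact SimpleGraph.deleteEdges_adj.2 ⟨R.adj n, hn⟩
  obtain ⟨C, hC⟩ := ray_eventually R.toFun hev
  exact ⟨C, hC, hC⟩

theorem EdgeEquiv.trans {R L M : Ray G} (h₁ : EdgeEquiv R L) (h₂ : EdgeEquiv L M) :
    EdgeEquiv R M := by
  intro S hS hSG
  obtain ⟨C, hC, hC'⟩ := h₁ S hS hSG
  obtain ⟨D, hD, hD'⟩ := h₂ S hS hSG
  obtain ⟨n, hn, hn'⟩ := (hC'.and hD).exists
  have hCD : C = D := by
    rw [SimpleGraph.ConnectedComponent.mem_supp_iff] at hn hn'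
    rw [← hn, ← hn']
  subst hCD
  exact ⟨C, hC, hD'⟩

theorem VertexEquiv.refl (R : Ray G) : VertexEquiv R R := by
  intro S hS
  have hev : ∀ᶠ n in atTop, R.toFun n ∉ S := by
    rw [← Nat.cofinite_eq_atTop]
    exact (hS.preimage (R.injective.injOn (s := _))).compl_mem_cofinite
  obtain ⟨N, hN⟩ := eventually_atTop.1 hev
  refine ⟨G.componentComplMk (hN N le_rfl), ?_⟩
  have : ∀ᶠ n in atTop, R.toFun n ∈ G.componentComplMk (hN N le_rfl) := by
    refine eventually_atTop.2 ⟨N, fun n hn => ?_⟩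
    induction n, hn using Nat.le_induction with
    | base => exact ⟨hN N le_rfl, rfl⟩
    | succ n hn ih =>
      exact SimpleGraph.ComponentCompl.mem_of_adj _ _ ih (hN (n + 1) (by omega)) (R.adj n)
  exact ⟨this, this⟩

theorem VertexEquiv.trans {R L M : Ray G} (h₁ : VertexEquiv R L) (h₂ : VertexEquiv L M) :
    VertexEquiv R M := by
  intro S hS
  obtain ⟨C, hC, hC'⟩ := h₁ S hS
  obtain ⟨D, hD, hD'⟩ := h₂ S hS
  obtain ⟨n, ⟨_, hn⟩, ⟨_, hn'⟩⟩ := (hC'.and hD).exists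
  have hCD : C = D := by rw [← hn, ← hn']
  subst hCD
  exact ⟨C, hC, hD'⟩

variable (G)

/-- Edge-equivalence of rays, as a setoid. -/
def edgeSetoid : Setoid (Ray G) where
  r := EdgeEquiv
  iseqv := ⟨EdgeEquiv.refl, fun h S hS hSG => (h S hS hSG).imp fun _ hC => hC.symm,
    EdgeEquiv.trans⟩

/-- Vertex-equivalence of rays, as a setoid. -/
def vertexSetoid : Setoid (Ray G) where
  r := VertexEquiv
  iseqv := ⟨VertexEquiv.refl, fun h S hS => (h S hS).imp fun _ hC => hC.symm,
    VertexEquiv.trans⟩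

/-- The edge-ends of `G`. -/
abbrev EdgeEnd : Type u := Quotient (edgeSetoid G)

/-- The vertex-ends of `G`. -/
abbrev VertexEnd : Type u := Quotient (vertexSetoid G)

end Ends

/-! ### The space `ETOP(G)` -/

section Etop

variable (G : SimpleGraph V)

/-- The points of `ETOP'(G)`: the points of the 1-complex `G`, and the edge-ends of `G`. -/
inductive EtopPre : Type u
  | point (x : OneComplex G) : EtopPre
  | edgeEnd (ω : EdgeEnd G) : EtopPre

variable {G}

/-- For a set `S` of edges and a component `C` of `G - S`, the set of the points of `C` (its vertices
and the inner points of its edges). -/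
def edgeCompPoints (S : Set (Sym2 V)) (C : (G.deleteEdges S).ConnectedComponent) :
    Set (OneComplex G) :=
  {x | (∃ v ∈ C.supp, x = .vertex v) ∨
    ∃ (e : G.edgeSet) (t : Set.Ioo (0 : ℝ) 1),
      (e : Sym2 V) ∉ S ∧ src e ∈ C.supp ∧ tgt e ∈ C.supp ∧ x = .inner e t}

/-- The set of the edge-ends of `G` that have a ray in the component `C` of `G - S`. -/
def edgeCompEnds (S : Set (Sym2 V)) (C : (G.deleteEdges S).ConnectedComponent) :
    Set (EdgeEnd G) :=
  {ω | ∃ R : Ray G, Quotient.mk (edgeSetoid G) R = ω ∧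
    ∀ n, R.toFun n ∈ C.supp ∧ s(R.toFun n, R.toFun (n + 1)) ∉ S}

/-- A union of half-edges `(z, y]` (without their vertex `y`, which is a point of `C`), one for every
edge in `S` and every endvertex `y` of that edge in `C`. The inner points `z` are given by `a` at
the first endvertices and by `b` at the second endvertices of the edges. -/
def edgeCompHalfEdges (S : Set (Sym2 V)) (C : (G.deleteEdges S).ConnectedComponent)
    (a b : G.edgeSet → Set.Ioo (0 : ℝ) 1) : Set (OneComplex G) :=
  {x | ∃ (e : G.edgeSet) (t : Set.Ioo (0 : ℝ) 1), (e : Sym2 V) ∈ S ∧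
    ((src e ∈ C.supp ∧ t < a e) ∨ (tgt e ∈ C.supp ∧ b e < t)) ∧ x = .inner e t}

/-- The topology of `ETOP'(G)`: it is generated by the open subsets of the interiors of the edges,
and by the sets that consist of a component `C` of `G - S`, where `S` is a finite set of edges, the
edge-ends that have a ray in `C`, and a half-edge at every endvertex in `C` of an edge in `S`. -/
instance : TopologicalSpace (EtopPre G) :=
  TopologicalSpace.generateFrom
    ({O | ∃ (e : G.edgeSet) (U : Set (Set.Ioo (0 : ℝ) 1)), IsOpen U ∧
        O = (fun t => EtopPre.point (.inner e t)) '' U} ∪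
      {O | ∃ (S : Set (Sym2 V)) (C : (G.deleteEdges S).ConnectedComponent)
        (a b : G.edgeSet → Set.Ioo (0 : ℝ) 1), S.Finite ∧ S ⊆ G.edgeSet ∧
        O = EtopPre.point '' edgeCompPoints S C ∪ EtopPre.edgeEnd '' edgeCompEnds S C ∪
          EtopPre.point '' edgeCompHalfEdges S C a b})

variable (G)

/-- The space `ETOP(G)`, obtained from `ETOP'(G)` by identifying any two points that have the same
open neighbourhoods. -/
abbrev Etop : Type u := SeparationQuotient (EtopPre G)

variable {G}

/-- The canonical map from the 1-complex `G` to `ETOP(G)`. -/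
def toEtop (x : OneComplex G) : Etop G := SeparationQuotient.mk (.point x)

end Etop

/-! ### The Freudenthal compactification of a locally finite graph -/

section Freudenthal

variable (G : SimpleGraph V)

/-- The points of `|G|`: the points of the 1-complex `G`, and the (vertex-)ends of `G`. -/
inductive Freudenthal : Type u
  | point (x : OneComplex G) : Freudenthal
  | vertexEnd (ω : VertexEnd G) : Freudenthal

variable {G}

/-- An open star around the vertex `v`: a union of half-edges `[v, z)`, one at each edge at `v`. -/
def openStar (v : V) (a b : G.edgeSet → Set.Ioo (0 : ℝ) 1) : Set (OneComplex G) :=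
  {x | x = .vertex v ∨ ∃ (e : G.edgeSet) (t : Set.Ioo (0 : ℝ) 1),
    ((src e = v ∧ t < a e) ∨ (tgt e = v ∧ b e < t)) ∧ x = .inner e t}

/-- For a set `S` of vertices and a component `C` of `G - S`, the set of the points of `C` (its
vertices and the inner points of its edges). -/
def vertexCompPoints (S : Set V) (C : G.ComponentCompl S) : Set (OneComplex G) :=
  {x | (∃ v ∈ C, x = .vertex v) ∨
    ∃ (e : G.edgeSet) (t : Set.Ioo (0 : ℝ) 1), src e ∈ C ∧ tgt e ∈ C ∧ x = .inner e t}

/-- The set of the ends of `G` that have a ray in the component `C` of `G - S`. -/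
def vertexCompEnds (S : Set V) (C : G.ComponentCompl S) : Set (VertexEnd G) :=
  {ω | ∃ R : Ray G, Quotient.mk (vertexSetoid G) R = ω ∧ ∀ n, R.toFun n ∈ C}

/-- A union of half-edges `(z, y]` (without their vertex `y`), one for every edge `xy` with `x` in
`S` and `y` in `C`. -/
def vertexCompHalfEdges (S : Set V) (C : G.ComponentCompl S)
    (a b : G.edgeSet → Set.Ioo (0 : ℝ) 1) : Set (OneComplex G) :=
  {x | ∃ (e : G.edgeSet) (t : Set.Ioo (0 : ℝ) 1),
    ((src e ∈ C ∧ tgt e ∈ S ∧ t < a e) ∨ (tgt e ∈ C ∧ src e ∈ S ∧ b e < t)) ∧ x = .inner e t}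

/-- The topology of `|G|`: it is generated by the open subsets of the interiors of the edges, the
open stars around vertices, and the sets that consist of a component `C` of `G - S`, where `S` is a
finite set of vertices, the ends that have a ray in `C`, and a half-edge `(z, y]` for every edge
between `S` and a vertex `y` of `C`. -/
instance : TopologicalSpace (Freudenthal G) :=
  TopologicalSpace.generateFrom
    ({O | ∃ (e : G.edgeSet) (U : Set (Set.Ioo (0 : ℝ) 1)), IsOpen U ∧
        O = (fun t => Freudenthal.point (.inner e t)) '' U} ∪
      {O | ∃ (v : V) (a b : G.edgeSet → Set.Ioo (0 : ℝ) 1),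
        O = Freudenthal.point '' openStar v a b} ∪
      {O | ∃ (S : Set V) (C : G.ComponentCompl S)
        (a b : G.edgeSet → Set.Ioo (0 : ℝ) 1), S.Finite ∧
        O = Freudenthal.point '' vertexCompPoints S C ∪
          Freudenthal.vertexEnd '' vertexCompEnds S C ∪
          Freudenthal.point '' vertexCompHalfEdges S C a b})

end Freudenthal

end GraphSpace

/-! Both topologies are governed by the components `C` of `G - F`, for finite sets `F` of edges. Two
opposite estimates compare them.

Small from inside: a path in `C` avoids `F` and uses every other edge at most once, so its length is
at most the total length of the edges outside `F`. By summability this bound tends to `0` as `F`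
grows (`exists_path_le_tailLength`, `tendsto_tailLength`). Hence rays are Cauchy, edge-equivalent
rays have the same limit, and the map from `G` to its completion extends to a continuous map `Φ` on
`ETOP'(G)`.

Separated from outside: an arc from a vertex of `C` to a point outside a basic neighbourhood of `C`
runs through a cut edge or through one of the prescribed half-edges. As these are finitely many and
of positive length, the arc is not too short (`ArcLength.le_of_notMem_edgeCompNhd`). Hence `Φ` is
inducing.

For surjectivity, a point of the completion outside the image of `G` is a limit of vertices. These
choose a component for each member of an exhausting sequence of finite edge sets. The components
decrease and their diameters tend to `0`. Either some vertex lies in all of them and is mapped to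
the point, or `exists_ray_of_antitone` gives a ray that converges to it. An inducing surjection onto
a Hausdorff space becomes a homeomorphism once inseparable points are identified, which gives
`ETOP(G)`.

If `G` is locally finite, a finite vertex set can be traded for the finite set of its incident
edges, and a finite edge set for its endvertices. So ends and edge-ends coincide, the basic open
sets match, and since `|G|` is T0 it is homeomorphic to `ETOP(G)`. -/

namespace GraphSpace

universe u

variable {V : Type u}

/-! ### Rays along decreasing sequences of components -/

section RayConstruction

open Filter

/-- A decreasing sequence of components with empty intersection contains tails of a common ray. -/
theorem exists_ray_of_antitone {G : SimpleGraph V} (H : ℕ → SimpleGraph V) (hH : ∀ k, H k ≤ G)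
    (C : ∀ k, (H k).ConnectedComponent) (hanti : ∀ k, (C (k + 1)).supp ⊆ (C k).supp)
    (hne : ∀ u, ∃ k, u ∉ (C k).supp) :
    ∃ R : Ray G, ∀ k, ∀ᶠ n in atTop, R.toFun n ∈ (C k).supp := by
  classical
  have hmono : ∀ {j k : ℕ}, j ≤ k → (C k).supp ⊆ (C j).supp := fun hjk =>
    antitone_nat_of_succ_le (f := fun k => (C k).supp) hanti hjk
  let K : V → ℕ := fun u => Nat.find (hne u)
  have hK : ∀ u j, j < K u ↔ u ∈ (C j).supp := by
    intro u j
    constructor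
    · intro h
      exact not_not.1 (Nat.find_min (hne u) h)
    · intro h
      by_contra hlt
      exact Nat.find_spec (hne u) (hmono (not_lt.1 hlt) h)
  -- For `u` in `C 0`, `D u` is the distance from `u` to the first component that misses it,
  -- measured in the last graph where both still lie in one component. The first edge of a shortest
  -- walk raises `K`, or keeps `K` and lowers `D`.
  let T : V → Set ℕ := fun u =>
    {n | ∃ y ∈ (C (K u)).supp, ∃ p : (H (K u - 1)).Walk u y, p.length = n}
  let D : V → ℕ := fun u => sInf (T u)
  have step : ∀ x : {x // x ∈ (C 0).supp}, ∃ x' : {x // x ∈ (C 0).supp},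
      G.Adj x x' ∧ (K x < K x' ∨ K x = K x' ∧ D x' < D x) := by
    rintro ⟨x, hx⟩
    have hpos : 0 < K x := (hK x 0).2 hx
    have hx1 : x ∈ (C (K x - 1)).supp := (hK x _).1 (by omega)
    obtain ⟨y0, hy0⟩ := (C (K x)).nonempty_supp
    have hy1 : y0 ∈ (C (K x - 1)).supp := hmono (by omega) hy0
    have hreach : (H (K x - 1)).Reachable x y0 := by
      rw [SimpleGraph.ConnectedComponent.mem_supp_iff] at hx1 hy1
      exact SimpleGraph.ConnectedComponent.exact (hx1.trans hy1.symm)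
    obtain ⟨p0⟩ := hreach
    have hT : (T x).Nonempty := ⟨_, y0, hy0, p0, rfl⟩
    obtain ⟨y, hy, p, hp⟩ := Nat.sInf_mem hT
    have hDx : p.length = D x := hp
    cases p with
    | nil => exact absurd ((hK x _).2 hy) (lt_irrefl _)
    | @cons _ x' _ h q =>
      have hx'1 : x' ∈ (C (K x - 1)).supp := by
        rw [SimpleGraph.ConnectedComponent.mem_supp_iff] at hx1 ⊢
        rw [← hx1]
        exact SimpleGraph.ConnectedComponent.sound h.symm.reachable
      have hle : K x ≤ K x' := by
        have := (hK x' _).2 hx'1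
        omega
      refine ⟨⟨x', hmono (Nat.zero_le _) hx'1⟩, hH _ h, ?_⟩
      rcases hle.lt_or_eq with hlt | heq
      · exact Or.inl hlt
      · refine Or.inr ⟨heq, ?_⟩
        have hmem : q.length ∈ T x' := by
          change ∃ y ∈ (C (K x')).supp, ∃ p : (H (K x' - 1)).Walk x' y, p.length = q.length
          rw [← heq]
          exact ⟨y, hy, q, rfl⟩
        have : D x' ≤ q.length := Nat.sInf_le hmem
        rw [SimpleGraph.Walk.length_cons] at hDx
        change D x' < D x
        omega
  choose next hadj hnext using step
  obtain ⟨x0, hx0⟩ := (C 0).nonempty_supp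
  let f : ℕ → {x // x ∈ (C 0).supp} := fun n => next^[n] ⟨x0, hx0⟩
  have hf : ∀ n, f (n + 1) = next (f n) := fun n => Function.iterate_succ_apply' _ _ _
  -- Strict lexicographic growth means that no vertex is repeated.
  have hlex : StrictMono fun n => toLex (K (f n), OrderDual.toDual (D (f n))) := by
    refine strictMono_nat_of_lt_succ fun n => ?_
    rw [Prod.Lex.toLex_lt_toLex]
    change K (f n) < K (f (n + 1)) ∨ K (f n) = K (f (n + 1)) ∧ D (f (n + 1)) < D (f n)
    rw [hf]
    exact hnext (f n)
  have hKmono : Monotone fun n => K (f n) := by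
    refine monotone_nat_of_le_succ fun n => ?_
    rw [hf]
    rcases hnext (f n) with h | h
    · exact h.le
    · exact h.1.le
  -- While `K` is constant the natural number `D` drops, so `K` must grow eventually.
  have hgrow : ∀ d n, D (f n) = d → ∃ m, K (f n) < K (f m) := by
    intro d
    induction d using Nat.strong_induction_on with
    | _ d ih =>
      intro n hn
      rcases hnext (f n) with h | ⟨h1, h2⟩
      · exact ⟨n + 1, by rw [hf]; exact h⟩
      · rw [← hf] at h1 h2
        obtain ⟨m, hm⟩ := ih _ (hn ▸ h2) (n + 1) rfl
        exact ⟨m, h1 ▸ hm⟩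
  have hunb : ∀ k, ∃ n, k < K (f n) := by
    intro k
    induction k with
    | zero => exact ⟨0, (hK _ 0).2 (f 0).2⟩
    | succ k ih =>
      obtain ⟨n, hn⟩ := ih
      obtain ⟨m, hm⟩ := hgrow _ n rfl
      exact ⟨m, by omega⟩
  refine ⟨⟨fun n => f n, fun m n hmn => ?_, fun n => ?_⟩, fun k => ?_⟩
  · refine hlex.injective ?_
    have : (f m : V) = f n := hmn
    simp only [this]
  · simp only [hf]
    exact hadj (f n)
  · obtain ⟨n, hn⟩ := hunb k
    exact eventually_atTop.2 ⟨n, fun m hm => (hK _ k).1 (hn.trans_le (hKmono hm))⟩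

end RayConstruction

/-! ### Finite edge cuts, rays and basic open sets -/

section Cuts

open Filter

variable {G : SimpleGraph V}

theorem mem_supp_of_adj {H : SimpleGraph V} {C : H.ConnectedComponent} {v w : V}
    (hv : v ∈ C.supp) (h : H.Adj v w) : w ∈ C.supp := by
  rw [SimpleGraph.ConnectedComponent.mem_supp_iff] at hv ⊢
  rw [← hv]
  exact SimpleGraph.ConnectedComponent.sound h.symm.reachable

theorem supp_subset_of_le {H K : SimpleGraph V} (hHK : H ≤ K) {C : H.ConnectedComponent}
    {D : K.ConnectedComponent} {v : V} (hC : v ∈ C.supp) (hD : v ∈ D.supp) :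
    C.supp ⊆ D.supp := by
  intro w hw
  rw [SimpleGraph.ConnectedComponent.mem_supp_iff] at hC hD hw ⊢
  rw [← hD]
  exact SimpleGraph.ConnectedComponent.sound
    ((SimpleGraph.ConnectedComponent.exact (hw.trans hC.symm)).mono hHK)

theorem src_mem_iff_tgt_mem {S : Set (Sym2 V)} {C : (G.deleteEdges S).ConnectedComponent}
    {e : G.edgeSet} (he : (e : Sym2 V) ∉ S) : src e ∈ C.supp ↔ tgt e ∈ C.supp := by
  have h : (G.deleteEdges S).Adj (src e) (tgt e) :=
    SimpleGraph.deleteEdges_adj.2 ⟨adj_src_tgt e, by rwa [mk_src_tgt]⟩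
  exact ⟨fun hs => mem_supp_of_adj hs h, fun ht => mem_supp_of_adj ht h.symm⟩

theorem Ray.edge_injective (R : Ray G) :
    Function.Injective fun n => s(R.toFun n, R.toFun (n + 1)) := by
  intro m n hmn
  rcases Sym2.eq_iff.1 hmn with ⟨h, -⟩ | ⟨h1, h2⟩
  · exact R.injective h
  · have h1 := R.injective h1
    have h2 := R.injective h2
    omega

theorem Ray.eventually_edge_notMem (R : Ray G) {S : Set (Sym2 V)} (hS : S.Finite) :
    ∀ᶠ n in atTop, s(R.toFun n, R.toFun (n + 1)) ∉ S := by
  rw [← Nat.cofinite_eq_atTop]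
  exact (hS.preimage R.edge_injective.injOn).compl_mem_cofinite

theorem Ray.exists_component (R : Ray G) {S : Set (Sym2 V)} (hS : S.Finite) :
    ∃ C : (G.deleteEdges S).ConnectedComponent, ∀ᶠ n in atTop, R.toFun n ∈ C.supp := by
  refine ray_eventually R.toFun ?_
  filter_upwards [R.eventually_edge_notMem hS] with n hn
  exact SimpleGraph.deleteEdges_adj.2 ⟨R.adj n, hn⟩

/-- The tail of a ray that starts at its `N`th vertex. -/
def Ray.drop (R : Ray G) (N : ℕ) : Ray G where
  toFun n := R.toFun (n + N)
  injective m n h := by simpa using R.injective h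
  adj n := by simpa [Nat.add_right_comm] using R.adj (n + N)

theorem Ray.edgeEquiv_drop (R : Ray G) (N : ℕ) : EdgeEquiv (R.drop N) R := by
  intro S hS _
  obtain ⟨C, hC⟩ := R.exists_component hS
  exact ⟨C, (tendsto_add_atTop_nat N).eventually hC, hC⟩

theorem Ray.vertexEquiv_drop (R : Ray G) (N : ℕ) : VertexEquiv (R.drop N) R := by
  intro S hS
  obtain ⟨C, hC, -⟩ := VertexEquiv.refl R S hS
  exact ⟨C, (tendsto_add_atTop_nat N).eventually hC, hC⟩

/-- `edgeCompEnds` wants a ray that lies in `C` entirely; dropping a finite initial segment achieves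
this within the edge-end. -/
theorem mk_mem_edgeCompEnds (R : Ray G) {S : Set (Sym2 V)} (hS : S.Finite)
    {C : (G.deleteEdges S).ConnectedComponent} (hR : ∀ᶠ n in atTop, R.toFun n ∈ C.supp) :
    Quotient.mk (edgeSetoid G) R ∈ edgeCompEnds S C := by
  obtain ⟨N, hN⟩ := eventually_atTop.1 (hR.and (R.eventually_edge_notMem hS))
  refine ⟨R.drop N, Quotient.sound (R.edgeEquiv_drop N), fun n => ?_⟩
  have h := hN (n + N) (by omega)
  refine ⟨h.1, ?_⟩
  have h2 := h.2
  rwa [Nat.add_right_comm] at h2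

theorem mk_mem_vertexCompEnds (R : Ray G) {S : Set V} {C : G.ComponentCompl S}
    (hR : ∀ᶠ n in atTop, R.toFun n ∈ C) :
    Quotient.mk (vertexSetoid G) R ∈ vertexCompEnds S C := by
  obtain ⟨N, hN⟩ := eventually_atTop.1 hR
  exact ⟨R.drop N, Quotient.sound (R.vertexEquiv_drop N), fun n => hN (n + N) (by omega)⟩

/-- A walk that leaves a component of `G - S` is at least as long as some edge in `S`. -/
theorem exists_edge_le_walkLength (ℓ : G.edgeSet → ℝ≥0) {S : Set (Sym2 V)}
    {C : (G.deleteEdges S).ConnectedComponent} {v w : V} (p : G.Walk v w) (hv : v ∈ C.supp)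
    (hw : w ∉ C.supp) : ∃ e : G.edgeSet, (e : Sym2 V) ∈ S ∧ (ℓ e : ℝ) ≤ walkLength ℓ p := by
  induction p with
  | nil => exact absurd hv hw
  | @cons u v w h p ih =>
    rw [walkLength_cons]
    by_cases hS : s(u, v) ∈ S
    · exact ⟨⟨s(u, v), h⟩, hS, le_add_of_nonneg_right (walkLength_nonneg ℓ p)⟩
    · obtain ⟨e, he, hle⟩ :=
        ih (mem_supp_of_adj hv (SimpleGraph.deleteEdges_adj.2 ⟨h, hS⟩)) hw
      exact ⟨e, he, hle.trans (le_add_of_nonneg_left (NNReal.coe_nonneg _))⟩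

/-- The basic open set of `ETOP'(G)` given by a component `C` of `G - S`. -/
def edgeCompNhd (S : Set (Sym2 V)) (C : (G.deleteEdges S).ConnectedComponent)
    (a b : G.edgeSet → Set.Ioo (0 : ℝ) 1) : Set (EtopPre G) :=
  EtopPre.point '' edgeCompPoints S C ∪ EtopPre.edgeEnd '' edgeCompEnds S C ∪
    EtopPre.point '' edgeCompHalfEdges S C a b

theorem isOpen_edgeCompNhd {S : Set (Sym2 V)} (hS : S.Finite) (hSG : S ⊆ G.edgeSet)
    (C : (G.deleteEdges S).ConnectedComponent) (a b : G.edgeSet → Set.Ioo (0 : ℝ) 1) :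
    IsOpen (edgeCompNhd S C a b) :=
  TopologicalSpace.isOpen_generateFrom_of_mem (Or.inr ⟨S, C, a, b, hS, hSG, rfl⟩)

theorem isOpen_image_inner (e : G.edgeSet) {U : Set (Set.Ioo (0 : ℝ) 1)} (hU : IsOpen U) :
    IsOpen ((fun t => EtopPre.point (.inner e t)) '' U) :=
  TopologicalSpace.isOpen_generateFrom_of_mem (Or.inl ⟨e, U, hU, rfl⟩)

section Membership

variable {S : Set (Sym2 V)} {C : (G.deleteEdges S).ConnectedComponent}
  {a b : G.edgeSet → Set.Ioo (0 : ℝ) 1}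

@[simp]
theorem vertex_mem_edgeCompNhd {v : V} :
    EtopPre.point (.vertex v) ∈ edgeCompNhd S C a b ↔ v ∈ C.supp := by
  simp [edgeCompNhd, edgeCompPoints, edgeCompHalfEdges]

@[simp]
theorem edgeEnd_mem_edgeCompNhd {ω : EdgeEnd G} :
    EtopPre.edgeEnd ω ∈ edgeCompNhd S C a b ↔ ω ∈ edgeCompEnds S C := by
  simp [edgeCompNhd]

theorem inner_mem_edgeCompNhd_of_notMem {e : G.edgeSet} {t : Set.Ioo (0 : ℝ) 1}
    (he : (e : Sym2 V) ∉ S) :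
    EtopPre.point (.inner e t) ∈ edgeCompNhd S C a b ↔ src e ∈ C.supp := by
  have h := src_mem_iff_tgt_mem (C := C) he
  constructor
  · rintro ((⟨_, ⟨v, -, rfl⟩ | ⟨e', t', -, h1, -, rfl⟩, heq⟩ | ⟨_, -, heq⟩) |
      ⟨_, ⟨e', t', h1, -, rfl⟩, heq⟩)
    · cases heq
    · cases heq
      exact h1
    · cases heq
    · cases heq
      exact absurd h1 he
  · intro hs
    exact Or.inl (Or.inl ⟨_, Or.inr ⟨e, t, he, hs, h.1 hs, rfl⟩, rfl⟩)

theorem inner_mem_edgeCompNhd_of_mem {e : G.edgeSet} {t : Set.Ioo (0 : ℝ) 1}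
    (he : (e : Sym2 V) ∈ S) :
    EtopPre.point (.inner e t) ∈ edgeCompNhd S C a b ↔
      (src e ∈ C.supp ∧ t < a e) ∨ (tgt e ∈ C.supp ∧ b e < t) := by
  constructor
  · rintro ((⟨_, ⟨v, -, rfl⟩ | ⟨e', t', h1, -, -, rfl⟩, heq⟩ | ⟨_, -, heq⟩) |
      ⟨_, ⟨e', t', -, h1, rfl⟩, heq⟩)
    · cases heq
    · cases heq
      exact absurd he h1
    · cases heq
    · cases heq
      exact h1
  · intro h
    exact Or.inr ⟨_, ⟨e, t, he, h, rfl⟩, rfl⟩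

/-- The inner points of an edge in a basic open set of `ETOP'(G)` form an open subset. -/
theorem exists_isOpen_inner_subset {e : G.edgeSet} {t : Set.Ioo (0 : ℝ) 1}
    (h : EtopPre.point (.inner e t) ∈ edgeCompNhd S C a b) :
    ∃ U : Set (Set.Ioo (0 : ℝ) 1), IsOpen U ∧ t ∈ U ∧
      (fun t => EtopPre.point (.inner e t)) '' U ⊆ edgeCompNhd S C a b := by
  by_cases he : (e : Sym2 V) ∈ S
  · rcases (inner_mem_edgeCompNhd_of_mem he).1 h with ⟨hs, ht⟩ | ⟨hs, ht⟩
    · refine ⟨Set.Iio (a e), isOpen_Iio, ht, ?_⟩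
      rintro _ ⟨s, hlt, rfl⟩
      exact (inner_mem_edgeCompNhd_of_mem he).2 (Or.inl ⟨hs, hlt⟩)
    · refine ⟨Set.Ioi (b e), isOpen_Ioi, ht, ?_⟩
      rintro _ ⟨s, hlt, rfl⟩
      exact (inner_mem_edgeCompNhd_of_mem he).2 (Or.inr ⟨hs, hlt⟩)
  · refine ⟨Set.univ, isOpen_univ, trivial, ?_⟩
    rintro _ ⟨s, -, rfl⟩
    exact (inner_mem_edgeCompNhd_of_notMem he).2 ((inner_mem_edgeCompNhd_of_notMem he).1 h)

end Membership

end Cuts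

/-! ### Length estimates for components of `G - F` -/

section TailLength

open Filter Topology

variable {G : SimpleGraph V} (ℓ : G.edgeSet → ℝ≥0)

/-- A finite set of edges of `G`, as a set of unordered pairs of vertices. -/
def edgeCut (F : Finset G.edgeSet) : Set (Sym2 V) := Subtype.val '' (F : Set G.edgeSet)

theorem finite_edgeCut (F : Finset G.edgeSet) : (edgeCut F).Finite :=
  F.finite_toSet.image _

theorem edgeCut_subset (F : Finset G.edgeSet) : edgeCut F ⊆ G.edgeSet := by
  rintro _ ⟨e, -, rfl⟩
  exact e.2

@[simp]
theorem mem_edgeCut {F : Finset G.edgeSet} {e : G.edgeSet} : (e : Sym2 V) ∈ edgeCut F ↔ e ∈ F := by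
  simp [edgeCut]

/-- The total length of the edges outside a finite set. -/
noncomputable def tailLength (F : Finset G.edgeSet) : ℝ :=
  ∑' e, ((F : Set G.edgeSet)ᶜ).indicator (fun e => (ℓ e : ℝ)) e

variable {ℓ}

theorem summable_indicator (hsum : Summable ℓ) (F : Finset G.edgeSet) :
    Summable (((F : Set G.edgeSet)ᶜ).indicator fun e => (ℓ e : ℝ)) :=
  (NNReal.summable_coe.2 hsum).indicator _

theorem tailLength_nonneg (F : Finset G.edgeSet) : 0 ≤ tailLength ℓ F :=
  tsum_nonneg fun e => Set.indicator_nonneg (fun e _ => (ℓ e).coe_nonneg) e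

theorem sum_le_tailLength (hsum : Summable ℓ) {F D : Finset G.edgeSet} (h : ∀ e ∈ D, e ∉ F) :
    ∑ e ∈ D, (ℓ e : ℝ) ≤ tailLength ℓ F := by
  refine le_trans (le_of_eq (Finset.sum_congr rfl fun e he => ?_))
    ((summable_indicator hsum F).sum_le_tsum D
      fun e _ => Set.indicator_nonneg (fun e _ => (ℓ e).coe_nonneg) e)
  rw [Set.indicator_of_mem]
  simpa using h e he

theorem length_le_tailLength (hsum : Summable ℓ) {F : Finset G.edgeSet} {e : G.edgeSet}
    (h : e ∉ F) : (ℓ e : ℝ) ≤ tailLength ℓ F := by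
  simpa using sum_le_tailLength hsum (F := F) (D := {e}) (by simpa using h)

theorem tendsto_tailLength : Tendsto (tailLength ℓ) atTop (𝓝 0) := by
  refine (tendsto_tsum_compl_atTop_zero fun e => (ℓ e : ℝ)).congr fun F => ?_
  exact tsum_subtype ((F : Set G.edgeSet)ᶜ) fun e => (ℓ e : ℝ)

theorem walkLength_le_tailLength (hsum : Summable ℓ) {F : Finset G.edgeSet} {v w : V}
    (p : G.Walk v w) (hp : p.edges.Nodup) (hF : ∀ e ∈ p.edges, e ∉ edgeCut F) :
    walkLength ℓ p ≤ tailLength ℓ F := by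
  classical
  let L : List G.edgeSet := p.darts.map fun d => ⟨d.edge, d.edge_mem⟩
  have hLe : L.map Subtype.val = p.edges := by
    simp [L, SimpleGraph.Walk.edges]
  have hL : L.Nodup := List.Nodup.of_map Subtype.val (hLe ▸ hp)
  have hw : walkLength ℓ p = ∑ e ∈ L.toFinset, (ℓ e : ℝ) := by
    rw [List.sum_toFinset _ hL, List.map_map]
    rfl
  rw [hw]
  refine sum_le_tailLength hsum fun e he => ?_
  have : (e : Sym2 V) ∈ p.edges := by
    rw [← hLe]
    exact List.mem_map_of_mem (List.mem_toFinset.1 he)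
  exact fun h => hF _ this (mem_edgeCut.2 h)

theorem exists_path_le_tailLength (hsum : Summable ℓ) {F : Finset G.edgeSet}
    {C : (G.deleteEdges (edgeCut F)).ConnectedComponent} {v w : V} (hv : v ∈ C.supp)
    (hw : w ∈ C.supp) : ∃ p : G.Walk v w, p.IsPath ∧ walkLength ℓ p ≤ tailLength ℓ F := by
  rw [SimpleGraph.ConnectedComponent.mem_supp_iff] at hv hw
  obtain ⟨p, hp⟩ := (SimpleGraph.ConnectedComponent.exact (hv.trans hw.symm)).exists_isPath
  have hle : G.deleteEdges (edgeCut F) ≤ G := SimpleGraph.deleteEdges_le _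
  have hp' : (p.mapLe hle).IsPath := (SimpleGraph.Walk.isPath_mapLe hle).2 hp
  refine ⟨p.mapLe hle, hp', walkLength_le_tailLength hsum _ hp'.isTrail.edges_nodup ?_⟩
  intro e he
  rw [SimpleGraph.Walk.edges_mapLe_eq_edges] at he
  have := p.edges_subset_edgeSet he
  rw [SimpleGraph.edgeSet_deleteEdges] at this
  exact this.2

/-- The three bounds cover crossing a cut edge and running past a prescribed half-edge at either
end; `δ ≤ 1` fits distances that are truncated at `1`. -/
theorem exists_pos_le_of_finite (hpos : ∀ e, 0 < ℓ e) {S : Set (Sym2 V)} (hS : S.Finite)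
    (a b : G.edgeSet → Set.Ioo (0 : ℝ) 1) :
    ∃ δ : ℝ, 0 < δ ∧ δ ≤ 1 ∧ ∀ e : G.edgeSet, (e : Sym2 V) ∈ S →
      δ ≤ ℓ e ∧ δ ≤ ℓ e * (a e : ℝ) ∧ δ ≤ ℓ e * (1 - (b e : ℝ)) := by
  have hfin : {e : G.edgeSet | (e : Sym2 V) ∈ S}.Finite :=
    hS.preimage Subtype.val_injective.injOn
  have key : ∀ r : ℝ, 0 < r → ∀ᶠ δ in 𝓝[>] (0 : ℝ), δ ≤ r := fun r hr =>
    (eventually_le_nhds hr).filter_mono nhdsWithin_le_nhds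
  have hall : ∀ᶠ δ : ℝ in 𝓝[>] (0 : ℝ), ∀ e ∈ {e : G.edgeSet | (e : Sym2 V) ∈ S},
      δ ≤ ℓ e ∧ δ ≤ ℓ e * (a e : ℝ) ∧ δ ≤ ℓ e * (1 - (b e : ℝ)) := by
    rw [Filter.eventually_all_finite hfin]
    intro e _
    have he : (0 : ℝ) < ℓ e := NNReal.coe_pos.2 (hpos e)
    exact (key _ he).and ((key _ (mul_pos he (a e).2.1)).and
      (key _ (mul_pos he (sub_pos.2 (b e).2.2))))
  obtain ⟨δ, ⟨h1, h2⟩, h3⟩ := ((hall.and (key 1 one_pos)).and self_mem_nhdsWithin).exists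
  exact ⟨δ, h3, h2, h1⟩

theorem exists_mem_Ioo_mul_le (r : ℝ≥0) {η : ℝ} (hη : 0 < η) :
    ∃ t : Set.Ioo (0 : ℝ) 1, r * (t : ℝ) ≤ η := by
  have h1 : (0 : ℝ) < r + 1 := by positivity
  -- The denominator `r + 1` also allows `r = 0`.
  refine ⟨⟨min (1 / 2) (η / (r + 1)), by positivity,
    (min_le_left _ _).trans_lt (by norm_num)⟩, ?_⟩
  calc (r : ℝ) * min (1 / 2) (η / (r + 1)) ≤ (r + 1) * (η / (r + 1)) := by
        gcongr
        · linarith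
        · exact min_le_right _ _
    _ = η := by field_simp

/-- Arcs from a component of `G - S` to the complement of one of its basic neighbourhoods are not
too short. -/
theorem ArcLength.le_of_notMem_edgeCompNhd {S : Set (Sym2 V)}
    {C : (G.deleteEdges S).ConnectedComponent} {a b : G.edgeSet → Set.Ioo (0 : ℝ) 1} {δ : ℝ}
    (hδ : ∀ e : G.edgeSet, (e : Sym2 V) ∈ S →
      δ ≤ ℓ e ∧ δ ≤ ℓ e * (a e : ℝ) ∧ δ ≤ ℓ e * (1 - (b e : ℝ)))
    {v : V} (hv : v ∈ C.supp) {y : OneComplex G} (hy : EtopPre.point y ∉ edgeCompNhd S C a b)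
    {r : ℝ} (h : ArcLength ℓ (.vertex v) y r) : δ ≤ r := by
  cases h with
  | @through _ _ _ w c d p hp hx hd =>
    cases hx
    have hd0 := hd.nonneg
    have hp0 := walkLength_nonneg ℓ p
    -- If the last vertex `w` is in `C`, then the final half-edge alone is long enough; otherwise
    -- the walk has left `C` through a whole cut edge.
    by_cases hw : w ∈ C.supp
    · suffices δ ≤ d by linarith
      cases hd with
      | vertex => exact absurd (vertex_mem_edgeCompNhd.2 hw) hy
      | src e t =>
        by_cases he : (e : Sym2 V) ∈ S
        · rw [inner_mem_edgeCompNhd_of_mem he] at hy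
          have hat : a e ≤ t := not_lt.1 fun hlt => hy (Or.inl ⟨hw, hlt⟩)
          exact (hδ e he).2.1.trans (mul_le_mul_of_nonneg_left hat (ℓ e).coe_nonneg)
        · exact absurd ((inner_mem_edgeCompNhd_of_notMem he).2 hw) hy
      | tgt e t =>
        by_cases he : (e : Sym2 V) ∈ S
        · rw [inner_mem_edgeCompNhd_of_mem he] at hy
          have hbt : t ≤ b e := not_lt.1 fun hlt => hy (Or.inr ⟨hw, hlt⟩)
          refine (hδ e he).2.2.trans (mul_le_mul_of_nonneg_left ?_ (ℓ e).coe_nonneg)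
          exact sub_le_sub_left (Subtype.coe_le_coe.2 hbt) 1
        · exact absurd ((inner_mem_edgeCompNhd_of_notMem he).2
            ((src_mem_iff_tgt_mem he).2 hw)) hy
    · obtain ⟨e, he, hle⟩ := exists_edge_le_walkLength ℓ p hv hw
      have := (hδ e he).1
      linarith

end TailLength

/-! ### The extension to edge-ends and its topology -/

section Extension

open Filter Topology

variable {G : SimpleGraph V} {M : Type*} [MetricSpace M]

/-- A map from the 1-complex `G` to a metric space that has dense image and whose distances agree,
up to truncation at `1`, with the infimum of the lengths of the arcs. -/
structure IsLengthEmbedding (ℓ : G.edgeSet → ℝ≥0) (ι : OneComplex G → M) : Prop where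
  denseRange : DenseRange ι
  dist_le : ∀ {x y : OneComplex G} {r : ℝ}, ArcLength ℓ x y r → dist (ι x) (ι y) ≤ r
  le_dist : ∀ {x y : OneComplex G} {δ : ℝ}, δ ≤ 1 → (∀ r, ArcLength ℓ x y r → δ ≤ r) →
    δ ≤ dist (ι x) (ι y)

/-- An extension of `ι` to `ETOP'(G)` that maps every edge-end to the limit of its rays. -/
structure IsEndExtension (ι : OneComplex G → M) (Φ : EtopPre G → M) : Prop where
  point : ∀ x, Φ (.point x) = ι x
  tendsto : ∀ R : Ray G, Tendsto (fun n => ι (.vertex (R.toFun n))) atTop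
    (𝓝 (Φ (.edgeEnd (Quotient.mk (edgeSetoid G) R))))

variable {ℓ : G.edgeSet → ℝ≥0} {ι : OneComplex G → M}

namespace IsLengthEmbedding

theorem dist_vertex_le (h : IsLengthEmbedding ℓ ι) (hsum : Summable ℓ) {F : Finset G.edgeSet}
    {C : (G.deleteEdges (edgeCut F)).ConnectedComponent} {v w : V} (hv : v ∈ C.supp)
    (hw : w ∈ C.supp) : dist (ι (.vertex v)) (ι (.vertex w)) ≤ tailLength ℓ F := by
  obtain ⟨p, hp, hle⟩ := exists_path_le_tailLength hsum hv hw
  have := h.dist_le (ArcLength.through p hp (.vertex v) (.vertex w))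
  linarith

theorem dist_src_le (h : IsLengthEmbedding ℓ ι) (e : G.edgeSet) (t : Set.Ioo (0 : ℝ) 1) :
    dist (ι (.vertex (src e))) (ι (.inner e t)) ≤ ℓ e * (t : ℝ) := by
  have := h.dist_le (ArcLength.through .nil .nil (.vertex (src e)) (.src e t))
  simpa [walkLength] using this

theorem dist_tgt_le (h : IsLengthEmbedding ℓ ι) (e : G.edgeSet) (t : Set.Ioo (0 : ℝ) 1) :
    dist (ι (.vertex (tgt e))) (ι (.inner e t)) ≤ ℓ e * (1 - (t : ℝ)) := by
  have := h.dist_le (ArcLength.through .nil .nil (.vertex (tgt e)) (.tgt e t))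
  simpa [walkLength] using this

theorem cauchySeq_ray (h : IsLengthEmbedding ℓ ι) (hsum : Summable ℓ) (R : Ray G) :
    CauchySeq fun n => ι (.vertex (R.toFun n)) := by
  rw [Metric.cauchySeq_iff]
  intro ε hε
  obtain ⟨F, hF⟩ := (tendsto_tailLength (ℓ := ℓ).eventually_lt_const hε).exists
  obtain ⟨C, hC⟩ := R.exists_component (finite_edgeCut F)
  obtain ⟨N, hN⟩ := eventually_atTop.1 hC
  exact ⟨N, fun m hm n hn => (h.dist_vertex_le hsum (hN m hm) (hN n hn)).trans_lt hF⟩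

theorem tendsto_of_edgeEquiv (h : IsLengthEmbedding ℓ ι) (hsum : Summable ℓ) {R L : Ray G}
    (hRL : EdgeEquiv R L) {z : M} (hz : Tendsto (fun n => ι (.vertex (R.toFun n))) atTop (𝓝 z)) :
    Tendsto (fun n => ι (.vertex (L.toFun n))) atTop (𝓝 z) := by
  refine hz.congr_dist (Metric.tendsto_atTop.2 fun ε hε => ?_)
  obtain ⟨F, hF⟩ := (tendsto_tailLength (ℓ := ℓ).eventually_lt_const hε).exists
  obtain ⟨C, hR, hL⟩ := hRL _ (finite_edgeCut F) (edgeCut_subset F)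
  obtain ⟨N, hN⟩ := eventually_atTop.1 (hR.and hL)
  refine ⟨N, fun n hn => ?_⟩
  rw [Real.dist_0_eq_abs, abs_of_nonneg dist_nonneg]
  exact (h.dist_vertex_le hsum (hN n hn).1 (hN n hn).2).trans_lt hF

/-- Completeness supplies the limit of one ray in each edge-end; `tendsto_of_edgeEquiv` makes it the
limit of all the others. -/
theorem exists_isEndExtension [CompleteSpace M] (h : IsLengthEmbedding ℓ ι) (hsum : Summable ℓ) :
    ∃ Φ : EtopPre G → M, IsEndExtension ι Φ := by
  have key : ∀ ω : EdgeEnd G, ∃ z : M, ∀ R : Ray G, Quotient.mk (edgeSetoid G) R = ω →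
      Tendsto (fun n => ι (.vertex (R.toFun n))) atTop (𝓝 z) := by
    intro ω
    obtain ⟨R, rfl⟩ := Quotient.exists_rep ω
    obtain ⟨z, hz⟩ := cauchySeq_tendsto_of_complete (h.cauchySeq_ray hsum R)
    refine ⟨z, fun L hL => h.tendsto_of_edgeEquiv hsum ?_ hz⟩
    exact Quotient.exact hL.symm
  choose f hf using key
  refine ⟨fun p => match p with
    | .point x => ι x
    | .edgeEnd ω => f ω, fun _ => rfl, fun R => hf _ R rfl⟩

/-- If `q` is an edge-end, its rays have tails in a component other than `C`, so the arc estimate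
holds along them and passes to the limit. -/
theorem le_dist_of_notMem (h : IsLengthEmbedding ℓ ι) {Φ : EtopPre G → M}
    (hΦ : IsEndExtension ι Φ) {S : Set (Sym2 V)} (hS : S.Finite)
    {C : (G.deleteEdges S).ConnectedComponent} {a b : G.edgeSet → Set.Ioo (0 : ℝ) 1} {δ : ℝ}
    (hδ1 : δ ≤ 1) (hδ : ∀ e : G.edgeSet, (e : Sym2 V) ∈ S →
      δ ≤ ℓ e ∧ δ ≤ ℓ e * (a e : ℝ) ∧ δ ≤ ℓ e * (1 - (b e : ℝ)))
    {v : V} (hv : v ∈ C.supp) {q : EtopPre G} (hq : q ∉ edgeCompNhd S C a b) :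
    δ ≤ dist (ι (.vertex v)) (Φ q) := by
  cases q with
  | point y =>
    rw [hΦ.point]
    exact h.le_dist hδ1 fun r hr => hr.le_of_notMem_edgeCompNhd hδ hv hq
  | edgeEnd ω =>
    obtain ⟨L, rfl⟩ := Quotient.exists_rep ω
    refine ge_of_tendsto ((tendsto_const_nhds (x := ι (.vertex v))).dist (hΦ.tendsto L)) ?_
    obtain ⟨D, hD⟩ := L.exists_component hS
    filter_upwards [hD] with n hn
    refine h.le_dist hδ1 fun r hr => hr.le_of_notMem_edgeCompNhd (a := a) (b := b) hδ hv ?_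
    rw [vertex_mem_edgeCompNhd]
    intro hC
    have hCD : C = D := by
      rw [SimpleGraph.ConnectedComponent.mem_supp_iff] at hn hC
      rw [← hn, ← hC]
    subst hCD
    exact hq (edgeEnd_mem_edgeCompNhd.2 (mk_mem_edgeCompEnds L hS hD))

theorem exists_ball_of_mem_inner (h : IsLengthEmbedding ℓ ι) (hpos : ∀ e, 0 < ℓ e)
    {Φ : EtopPre G → M} (hΦ : IsEndExtension ι Φ) (e : G.edgeSet) {U : Set (Set.Ioo (0 : ℝ) 1)}
    (hU : IsOpen U) {t : Set.Ioo (0 : ℝ) 1} (ht : t ∈ U) :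
    ∃ δ > 0, ∀ q, dist (ι (.inner e t)) (Φ q) < δ →
      q ∈ (fun t => EtopPre.point (.inner e t)) '' U := by
  obtain ⟨η, hη, hηU⟩ := Metric.isOpen_iff.1 hU t ht
  have he : (0 : ℝ) < ℓ e := NNReal.coe_pos.2 (hpos e)
  have h1 : (0 : ℝ) < 1 - t := sub_pos.2 t.2.2
  have h0 : (0 : ℝ) < t := t.2.1
  -- The bounds serve, in turn, the truncation, segments of `e` that leave `U`, and arcs that leave
  -- `e` through its first or second endvertex.
  let δ : ℝ := min (min 1 (ℓ e * η)) (min (ℓ e * (t : ℝ)) (ℓ e * (1 - (t : ℝ))))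
  have hδ0 : 0 < δ := by positivity
  have hδ1 : δ ≤ 1 := (min_le_left _ _).trans (min_le_left _ _)
  have hδη : δ ≤ ℓ e * η := (min_le_left _ _).trans (min_le_right _ _)
  have hδs : δ ≤ ℓ e * (t : ℝ) := (min_le_right _ _).trans (min_le_left _ _)
  have hδt : δ ≤ ℓ e * (1 - (t : ℝ)) := (min_le_right _ _).trans (min_le_right _ _)
  have key : ∀ y, (∀ s ∈ U, y ≠ .inner e s) → δ ≤ dist (ι (.inner e t)) (ι y) := by
    intro y hy
    refine h.le_dist hδ1 fun r hr => ?_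
    cases hr with
    | segment e t s =>
      refine hδη.trans (mul_le_mul_of_nonneg_left (not_lt.1 fun hlt => ?_) he.le)
      refine hy s (hηU ?_) rfl
      rw [Metric.mem_ball, Subtype.dist_eq, Real.dist_eq, abs_sub_comm]
      exact hlt
    | through p hp hx hd =>
      have h2 := hd.nonneg
      have h3 := walkLength_nonneg ℓ p
      cases hx <;> linarith
  refine ⟨δ, hδ0, fun q hq => ?_⟩
  by_contra hqU
  refine absurd hq (not_lt.2 ?_)
  cases q with
  | point y =>
    rw [hΦ.point]
    refine key y ?_
    rintro s hs rfl
    exact hqU ⟨s, hs, rfl⟩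
  | edgeEnd ω =>
    obtain ⟨L, rfl⟩ := Quotient.exists_rep ω
    refine ge_of_tendsto ((tendsto_const_nhds (x := ι (.inner e t))).dist (hΦ.tendsto L)) ?_
    exact Eventually.of_forall fun n => key _ fun s _ => by simp

theorem exists_ball_of_mem_edgeCompNhd (h : IsLengthEmbedding ℓ ι) (hpos : ∀ e, 0 < ℓ e)
    {Φ : EtopPre G → M} (hΦ : IsEndExtension ι Φ) {S : Set (Sym2 V)} (hS : S.Finite)
    (C : (G.deleteEdges S).ConnectedComponent) (a b : G.edgeSet → Set.Ioo (0 : ℝ) 1)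
    {p : EtopPre G} (hp : p ∈ edgeCompNhd S C a b) :
    ∃ δ > 0, ∀ q, dist (Φ p) (Φ q) < δ → q ∈ edgeCompNhd S C a b := by
  obtain ⟨δ, hδ0, hδ1, hδ⟩ := exists_pos_le_of_finite hpos hS a b
  cases p with
  | point x =>
    rw [hΦ.point]
    cases x with
    | vertex v =>
      rw [vertex_mem_edgeCompNhd] at hp
      refine ⟨δ, hδ0, fun q hq => ?_⟩
      by_contra hqU
      exact absurd hq (not_lt.2 (h.le_dist_of_notMem hΦ hS hδ1 hδ hp hqU))
    | inner e t =>
      obtain ⟨U, hU, htU, hsub⟩ := exists_isOpen_inner_subset hp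
      obtain ⟨ε, hε, hq⟩ := h.exists_ball_of_mem_inner hpos hΦ e hU htU
      exact ⟨ε, hε, fun q hlt => hsub (hq q hlt)⟩
  | edgeEnd ω =>
    obtain ⟨R, rfl, hR⟩ := edgeEnd_mem_edgeCompNhd.1 hp
    refine ⟨δ, hδ0, fun q hq => ?_⟩
    by_contra hqU
    refine absurd hq (not_lt.2 ?_)
    refine ge_of_tendsto ((hΦ.tendsto R).dist (tendsto_const_nhds (x := Φ q))) ?_
    exact Eventually.of_forall fun n => h.le_dist_of_notMem hΦ hS hδ1 hδ (hR n).1 hqU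

/-- One tail length pays for a path inside `C`, the second for a final piece of an edge outside `F`,
and `η` for a half-edge of a cut edge. -/
theorem dist_le_of_mem_edgeCompNhd (h : IsLengthEmbedding ℓ ι) (hsum : Summable ℓ)
    {Φ : EtopPre G → M} (hΦ : IsEndExtension ι Φ) {F : Finset G.edgeSet}
    {C : (G.deleteEdges (edgeCut F)).ConnectedComponent} {a b : G.edgeSet → Set.Ioo (0 : ℝ) 1}
    {η : ℝ} (hη : 0 ≤ η) (ha : ∀ e, ℓ e * (a e : ℝ) ≤ η) (hb : ∀ e, ℓ e * (1 - (b e : ℝ)) ≤ η)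
    {v : V} (hv : v ∈ C.supp) {q : EtopPre G} (hq : q ∈ edgeCompNhd (edgeCut F) C a b) :
    dist (ι (.vertex v)) (Φ q) ≤ 2 * tailLength ℓ F + η := by
  have hT := tailLength_nonneg (ℓ := ℓ) F
  cases q with
  | point x =>
    rw [hΦ.point]
    cases x with
    | vertex w =>
      have := h.dist_vertex_le hsum hv (vertex_mem_edgeCompNhd.1 hq)
      linarith
    | inner e t =>
      have hs := h.dist_src_le e t
      have ht := h.dist_tgt_le e t
      by_cases he : e ∈ F
      · rcases (inner_mem_edgeCompNhd_of_mem (mem_edgeCut.2 he)).1 hq with ⟨hC, hlt⟩ | ⟨hC, hlt⟩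
        · have h1 := h.dist_vertex_le hsum hv hC
          have h2 := dist_triangle (ι (.vertex v)) (ι (.vertex (src e))) (ι (.inner e t))
          have h3 : (ℓ e : ℝ) * t ≤ ℓ e * (a e : ℝ) :=
            mul_le_mul_of_nonneg_left (Subtype.coe_le_coe.2 hlt.le) (ℓ e).coe_nonneg
          linarith [ha e]
        · have h1 := h.dist_vertex_le hsum hv hC
          have h2 := dist_triangle (ι (.vertex v)) (ι (.vertex (tgt e))) (ι (.inner e t))
          have h3 : (ℓ e : ℝ) * (1 - t) ≤ ℓ e * (1 - (b e : ℝ)) :=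
            mul_le_mul_of_nonneg_left (sub_le_sub_left (Subtype.coe_le_coe.2 hlt.le) 1)
              (ℓ e).coe_nonneg
          linarith [hb e]
      · have hC := (inner_mem_edgeCompNhd_of_notMem (mt mem_edgeCut.1 he)).1 hq
        have h1 := h.dist_vertex_le hsum hv hC
        have h2 := dist_triangle (ι (.vertex v)) (ι (.vertex (src e))) (ι (.inner e t))
        have h3 : (ℓ e : ℝ) * t ≤ ℓ e := mul_le_of_le_one_right (ℓ e).coe_nonneg t.2.2.le
        linarith [length_le_tailLength hsum he]
  | edgeEnd ω =>
    obtain ⟨R, rfl, hR⟩ := edgeEnd_mem_edgeCompNhd.1 hq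
    refine le_of_tendsto ((tendsto_const_nhds (x := ι (.vertex v))).dist (hΦ.tendsto R)) ?_
    refine Eventually.of_forall fun n => ?_
    have := h.dist_vertex_le hsum hv (hR n).1
    linarith

/-- This serves vertices and edge-ends. An inner point can fail the hypothesis once its own edge is
cut. -/
theorem continuousAt_of_component (h : IsLengthEmbedding ℓ ι) (hsum : Summable ℓ)
    {Φ : EtopPre G → M} (hΦ : IsEndExtension ι Φ) {p : EtopPre G}
    (hp : ∀ F : Finset G.edgeSet, ∃ C : (G.deleteEdges (edgeCut F)).ConnectedComponent,
      ∀ a b, p ∈ edgeCompNhd (edgeCut F) C a b) : ContinuousAt Φ p := by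
  rw [ContinuousAt, Metric.tendsto_nhds]
  intro ε hε
  obtain ⟨F, hF⟩ :=
    -- Both `p` and `q` will be within `2 * (ε / 8) + ε / 8` of `v`, hence within `3 * ε / 4` of
    -- each other.
    (tendsto_tailLength (ℓ := ℓ).eventually_lt_const (show 0 < ε / 8 by positivity)).exists
  choose a ha using fun e => exists_mem_Ioo_mul_le (ℓ e) (show 0 < ε / 8 by positivity)
  let b : G.edgeSet → Set.Ioo (0 : ℝ) 1 := fun e =>
    ⟨1 - a e, sub_pos.2 (a e).2.2, sub_lt_self 1 (a e).2.1⟩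
  have hb : ∀ e, ℓ e * (1 - (b e : ℝ)) ≤ ε / 8 := fun e => by simpa [b] using ha e
  obtain ⟨C, hC⟩ := hp F
  obtain ⟨v, hv⟩ := C.nonempty_supp
  filter_upwards [(isOpen_edgeCompNhd (finite_edgeCut F) (edgeCut_subset F) C a b).mem_nhds
    (hC a b)] with q hq
  have h1 := h.dist_le_of_mem_edgeCompNhd hsum hΦ (by positivity) ha hb hv hq
  have h2 := h.dist_le_of_mem_edgeCompNhd hsum hΦ (by positivity) ha hb hv (hC a b)
  have h3 := dist_triangle_left (Φ q) (Φ p) (ι (.vertex v))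
  linarith

theorem continuous_extension (h : IsLengthEmbedding ℓ ι) (hsum : Summable ℓ)
    {Φ : EtopPre G → M} (hΦ : IsEndExtension ι Φ) : Continuous Φ := by
  rw [continuous_iff_continuousAt]
  intro p
  cases p with
  | point x =>
    cases x with
    | vertex v =>
      exact h.continuousAt_of_component hsum hΦ fun F =>
        ⟨SimpleGraph.connectedComponentMk _ v, fun a b => vertex_mem_edgeCompNhd.2 rfl⟩
    | inner e t =>
      rw [ContinuousAt, Metric.tendsto_nhds]
      intro ε hε
      have hU : IsOpen {s : Set.Ioo (0 : ℝ) 1 | (ℓ e : ℝ) * |(s : ℝ) - t| < ε} :=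
        isOpen_lt (by fun_prop) continuous_const
      filter_upwards [(isOpen_image_inner e hU).mem_nhds ⟨t, by simpa using hε, rfl⟩]
      rintro _ ⟨s, hs, rfl⟩
      rw [hΦ.point, hΦ.point]
      exact (h.dist_le (.segment e s t)).trans_lt hs
  | edgeEnd ω =>
    obtain ⟨R, rfl⟩ := Quotient.exists_rep ω
    refine h.continuousAt_of_component hsum hΦ fun F => ?_
    obtain ⟨C, hC⟩ := R.exists_component (finite_edgeCut F)
    exact ⟨C, fun a b => edgeEnd_mem_edgeCompNhd.2
      (mk_mem_edgeCompEnds R (finite_edgeCut F) hC)⟩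

theorem isInducing_extension (h : IsLengthEmbedding ℓ ι) (hpos : ∀ e, 0 < ℓ e)
    (hsum : Summable ℓ) {Φ : EtopPre G → M} (hΦ : IsEndExtension ι Φ) : IsInducing Φ := by
  rw [isInducing_iff_nhds]
  intro p
  refine le_antisymm (h.continuous_extension hsum hΦ).continuousAt.le_comap ?_
  rw [TopologicalSpace.nhds_generateFrom]
  refine le_iInf₂ fun O hO => le_principal_iff.2 ?_
  have key : ∃ δ > 0, ∀ q, dist (Φ p) (Φ q) < δ → q ∈ O := by
    obtain ⟨hpO, ⟨e, U, hU, rfl⟩ | ⟨S, C, a, b, hS, -, rfl⟩⟩ := hO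
    · obtain ⟨t, ht, rfl⟩ := hpO
      simpa only [hΦ.point] using h.exists_ball_of_mem_inner hpos hΦ e hU ht
    · exact h.exists_ball_of_mem_edgeCompNhd hpos hΦ hS C a b hpO
  obtain ⟨δ, hδ, hq⟩ := key
  refine mem_comap.2 ⟨_, Metric.ball_mem_nhds (Φ p) hδ, fun q hmem => hq q ?_⟩
  rw [dist_comm]
  exact hmem

/-- Limits of inner points of a fixed edge lie in the edge. -/
theorem exists_eq_of_frequently_inner (h : IsLengthEmbedding ℓ ι) {x : ℕ → OneComplex G} {z : M}
    (hx : Tendsto (fun n => ι (x n)) atTop (𝓝 z)) (e : G.edgeSet)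
    (he : ∃ᶠ n in atTop, ∃ t, x n = .inner e t) : ∃ y, ι y = z := by
  obtain ⟨φ, hφ, hφx⟩ := extraction_of_frequently_atTop he
  choose s hs using hφx
  obtain ⟨t, ht, ψ, hψ, hlim⟩ :=
    (isCompact_Icc (a := (0 : ℝ)) (b := 1)).tendsto_subseq (x := fun n => (s n : ℝ))
      fun n => Set.Ioo_subset_Icc_self (s n).2
  have hy : ∃ y, ∀ s : Set.Ioo (0 : ℝ) 1, dist (ι y) (ι (.inner e s)) ≤ ℓ e * |(s : ℝ) - t| := by
    -- The limit parameter may be `0` or `1`; then the limit is an endvertex.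
    rcases ht.1.eq_or_lt with rfl | h0
    · exact ⟨.vertex (src e), fun s => by
        simpa [abs_of_pos s.2.1] using h.dist_src_le e s⟩
    rcases ht.2.eq_or_lt with rfl | h1
    · exact ⟨.vertex (tgt e), fun s => by
        simpa [abs_sub_comm (s : ℝ) 1, abs_of_pos (sub_pos.2 s.2.2)] using h.dist_tgt_le e s⟩
    · exact ⟨.inner e ⟨t, h0, h1⟩, fun s => by
        simpa [abs_sub_comm] using h.dist_le (.segment e ⟨t, h0, h1⟩ s)⟩
  obtain ⟨y, hy⟩ := hy
  refine ⟨y, tendsto_nhds_unique (f := fun n => ι (.inner e (s (ψ n)))) (l := atTop) ?_ ?_⟩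
  · rw [tendsto_iff_dist_tendsto_zero]
    refine squeeze_zero (fun _ => dist_nonneg)
      (fun n => (dist_comm _ _).le.trans (hy (s (ψ n)))) ?_
    have h2 : Tendsto (fun n => (ℓ e : ℝ) * |(s (ψ n) : ℝ) - t|) atTop (𝓝 (ℓ e * |t - t|)) :=
      ((hlim.sub_const t).abs).const_mul _
    simpa using h2
  · exact (hx.comp (hφ.tendsto_atTop.comp hψ.tendsto_atTop)).congr fun n => by
      simp only [Function.comp, hs]

/-- Every point is an image of a point of `G`, or a limit of vertices. -/
theorem exists_eq_or_exists_tendsto_vertex (h : IsLengthEmbedding ℓ ι) (hsum : Summable ℓ)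
    (z : M) : (∃ y, ι y = z) ∨
      ∃ v : ℕ → V, Tendsto (fun n => ι (.vertex (v n))) atTop (𝓝 z) := by
  obtain ⟨x', hx', hlim'⟩ := mem_closure_iff_seq_limit.1 (h.denseRange z)
  choose x hx using hx'
  have hlim : Tendsto (fun n => ι (x n)) atTop (𝓝 z) := by simpa only [hx] using hlim'
  by_cases hfreq : ∃ e, ∃ᶠ n in atTop, ∃ t, x n = .inner e t
  · obtain ⟨e, he⟩ := hfreq
    exact Or.inl (h.exists_eq_of_frequently_inner hlim e he)
  right
  -- The vertex is chosen before `ε`, so that one sequence of vertices works for every `ε`.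
  have hnear : ∀ y : OneComplex G, ∃ v, ∀ ε > 0, (∀ e t, y = .inner e t → (ℓ e : ℝ) < ε) →
      dist (ι y) (ι (.vertex v)) < ε := by
    intro y
    cases y with
    | vertex v => exact ⟨v, fun ε hε _ => by simpa using hε⟩
    | inner e t =>
      refine ⟨src e, fun ε _ hlt => ?_⟩
      rw [dist_comm]
      exact ((h.dist_src_le e t).trans
        (mul_le_of_le_one_right (ℓ e).coe_nonneg t.2.2.le)).trans_lt (hlt e t rfl)
  choose w hw using hnear
  refine ⟨fun n => w (x n), hlim.congr_dist (Metric.tendsto_nhds.2 fun ε hε => ?_)⟩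
  -- Only finitely many edges are long, and each of them contains `x n` for only finitely many `n`.
  have hfin : {e : G.edgeSet | ¬ (ℓ e : ℝ) < ε}.Finite :=
    ((NNReal.summable_coe.2 hsum).tendsto_cofinite_zero.eventually_lt_const hε)
  have hev : ∀ᶠ n in atTop, ∀ e ∈ {e : G.edgeSet | ¬ (ℓ e : ℝ) < ε}, ¬ ∃ t, x n = .inner e t :=
    (Filter.eventually_all_finite hfin).2 fun e _ => not_frequently.1 fun hf => hfreq ⟨e, hf⟩
  filter_upwards [hev] with n hn
  rw [Real.dist_0_eq_abs, abs_of_nonneg dist_nonneg]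
  exact hw _ ε hε fun e t het => by_contra fun hlt => hn e hlt ⟨t, het⟩

/-- Vertices in distinct components of `G - S` are at least some fixed `δ` apart, so a Cauchy
sequence of vertices settles in one. The half-edges given by `a` are arbitrary, as only vertices are
tested. -/
theorem exists_component_of_tendsto (h : IsLengthEmbedding ℓ ι) (hpos : ∀ e, 0 < ℓ e) {z : M}
    {v : ℕ → V} (hv : Tendsto (fun n => ι (.vertex (v n))) atTop (𝓝 z)) {S : Set (Sym2 V)}
    (hS : S.Finite) :
    ∃ C : (G.deleteEdges S).ConnectedComponent, ∀ᶠ n in atTop, v n ∈ C.supp := by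
  let a : G.edgeSet → Set.Ioo (0 : ℝ) 1 := fun _ => ⟨1 / 2, by norm_num, by norm_num⟩
  obtain ⟨δ, hδ0, hδ1, hδ⟩ := exists_pos_le_of_finite hpos hS a a
  obtain ⟨N, hN⟩ := Metric.cauchySeq_iff.1 hv.cauchySeq δ hδ0
  refine ⟨SimpleGraph.connectedComponentMk _ (v N), eventually_atTop.2 ⟨N, fun n hn => ?_⟩⟩
  by_contra hC
  refine absurd (hN N le_rfl n hn) (not_lt.2 (h.le_dist hδ1 fun r hr => ?_))
  exact hr.le_of_notMem_edgeCompNhd hδ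
    (C := SimpleGraph.connectedComponentMk _ (v N)) rfl (mt vertex_mem_edgeCompNhd.1 hC)

theorem surjective_extension (h : IsLengthEmbedding ℓ ι) (hpos : ∀ e, 0 < ℓ e)
    (hsum : Summable ℓ) {Φ : EtopPre G → M} (hΦ : IsEndExtension ι Φ) :
    Function.Surjective Φ := by
  intro z
  rcases h.exists_eq_or_exists_tendsto_vertex hsum z with ⟨y, hy⟩ | ⟨v, hv⟩
  · exact ⟨.point y, by rw [hΦ.point, hy]⟩
  -- A summable positive family has a countable index set, so a sequence of finite edge sets can
  -- exhaust it.
  have hcount : Countable G.edgeSet := by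
    have hc := (NNReal.summable_coe.2 hsum).countable_support
    rw [← Set.countable_univ_iff]
    refine hc.mono fun e _ => ?_
    exact (NNReal.coe_pos.2 (hpos e)).ne'
  obtain ⟨F, hFmono, hF⟩ := exists_seq_monotone_tendsto_atTop_atTop (Finset G.edgeSet)
  choose C hC using fun k => h.exists_component_of_tendsto hpos hv (finite_edgeCut (F k))
  have hT : Tendsto (fun k => tailLength ℓ (F k)) atTop (𝓝 0) := tendsto_tailLength.comp hF
  have hdist : ∀ k, ∀ u ∈ (C k).supp, dist (ι (.vertex u)) z ≤ tailLength ℓ (F k) := by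
    intro k u hu
    refine le_of_tendsto (tendsto_const_nhds.dist hv) ?_
    filter_upwards [hC k] with n hn
    exact h.dist_vertex_le hsum hu hn
  by_cases hall : ∃ u, ∀ k, u ∈ (C k).supp
  · obtain ⟨u, hu⟩ := hall
    refine ⟨.point (.vertex u), ?_⟩
    rw [hΦ.point]
    exact dist_le_zero.1 (ge_of_tendsto' hT fun k => hdist k u (hu k))
  · push Not at hall
    obtain ⟨R, hR⟩ := exists_ray_of_antitone (fun k => G.deleteEdges (edgeCut (F k)))
      (fun k => SimpleGraph.deleteEdges_le _) C (fun k => by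
        obtain ⟨n, h1, h2⟩ := ((hC k).and (hC (k + 1))).exists
        refine supp_subset_of_le (SimpleGraph.deleteEdges_anti ?_) h2 h1
        exact Set.image_mono (Finset.coe_subset.2 (hFmono k.le_succ))) hall
    refine ⟨.edgeEnd (Quotient.mk _ R), tendsto_nhds_unique (hΦ.tendsto R) ?_⟩
    rw [Metric.tendsto_nhds]
    intro ε hε
    obtain ⟨k, hk⟩ := (hT.eventually_lt_const hε).exists
    filter_upwards [hR k] with n hn
    exact (hdist k _ hn).trans_lt hk

/-- A complete length embedding of `G` is homeomorphic to `ETOP(G)`. -/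
theorem exists_homeomorph_etop [CompleteSpace M] (h : IsLengthEmbedding ℓ ι)
    (hpos : ∀ e, 0 < ℓ e) (hsum : Summable ℓ) :
    ∃ f : M ≃ₜ Etop G, ∀ x, f (ι x) = toEtop x := by
  obtain ⟨Φ, hΦ⟩ := h.exists_isEndExtension hsum
  have hind := h.isInducing_extension hpos hsum hΦ
  have hΨ : ∀ p q, Inseparable p q → Φ p = Φ q := by
    intro p q hpq
    have : Inseparable (Φ p) (Φ q) := hind.inseparable_iff.2 hpq
    exact this.eq
  -- Inducing passes to the quotient, which is T0; injectivity then comes for free.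
  have hΨind : IsInducing (SeparationQuotient.lift Φ hΨ) := by
    rw [isInducing_iff_nhds]
    refine Quotient.ind fun p => ?_
    change 𝓝 (SeparationQuotient.mk p) = comap _ (𝓝 (Φ p))
    rw [← SeparationQuotient.map_mk_nhds, hind.nhds_eq_comap]
    change map SeparationQuotient.mk
      (comap (SeparationQuotient.lift Φ hΨ ∘ SeparationQuotient.mk) _) = _
    rw [← comap_comap, map_comap_of_surjective SeparationQuotient.surjective_mk]
  have hsurj : Function.Surjective (SeparationQuotient.lift Φ hΨ) := by
    intro z
    obtain ⟨p, rfl⟩ := h.surjective_extension hpos hsum hΦ z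
    exact ⟨SeparationQuotient.mk p, rfl⟩
  let g : Etop G ≃ₜ M :=
    (Equiv.ofBijective _ ⟨hΨind.injective, hsurj⟩).toHomeomorphOfIsInducing hΨind
  refine ⟨g.symm, fun x => ?_⟩
  rw [Homeomorph.symm_apply_eq]
  exact (hΦ.point x).symm

end IsLengthEmbedding

end Extension

/-! ### From the extended metric to a truncated metric -/

section Completion

open Filter Topology

/-- The truncation at `1` of an extended pseudometric, with the same uniform structure. -/
noncomputable abbrev truncatedPseudoMetric (X : Type*) [m : PseudoEMetricSpace X] :
    PseudoMetricSpace X where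
  dist x y := (min (edist x y) 1).toReal
  dist_self x := by simp
  dist_comm x y := by rw [edist_comm]
  dist_triangle x y z := by
    have hfin : ∀ r : ℝ≥0∞, min r 1 ≠ ∞ := fun r =>
      ((min_le_right _ _).trans_lt ENNReal.one_lt_top).ne
    rw [← ENNReal.toReal_add (hfin _) (hfin _)]
    refine ENNReal.toReal_mono (ENNReal.add_ne_top.2 ⟨hfin _, hfin _⟩) ?_
    rcases le_total (edist x y) 1 with h1 | h1
    · rcases le_total (edist y z) 1 with h2 | h2
      · rw [min_eq_left h1, min_eq_left h2]
        exact (min_le_left _ _).trans (edist_triangle x y z)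
      · rw [min_eq_right h2]
        exact (min_le_right _ _).trans le_add_self
    · rw [min_eq_right h1]
      exact (min_le_right _ _).trans le_self_add
  toUniformSpace := m.toUniformSpace
  uniformity_dist := by
    refine uniformity_dist_of_mem_uniformity (0 : ℝ)
      (fun x y : X => (min (edist x y) 1).toReal) fun s => ?_
    have hfin : ∀ r : ℝ≥0∞, min r 1 ≠ ∞ := fun r =>
      ((min_le_right _ _).trans_lt ENNReal.one_lt_top).ne
    rw [mem_uniformity_edist]
    constructor
    · rintro ⟨ε, hε, hs⟩
      have h1 : 0 < min ε 1 := lt_min hε one_pos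
      refine ⟨(min ε 1).toReal, ENNReal.toReal_pos h1.ne' (hfin _), fun {x y} hxy => hs ?_⟩
      rw [ENNReal.toReal_lt_toReal (hfin _) (hfin _)] at hxy
      by_contra hlt
      exact absurd hxy (not_lt.2 (min_le_min_right 1 (not_lt.1 hlt)))
    · rintro ⟨ε, hε, hs⟩
      refine ⟨ENNReal.ofReal ε, ENNReal.ofReal_pos.2 hε, fun {x y} hxy => hs ?_⟩
      rw [← ENNReal.lt_ofReal_iff_toReal_lt (hfin _)]
      exact (min_le_left _ _).trans_lt hxy

variable {G : SimpleGraph V} {ℓ : G.edgeSet → ℝ≥0}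

/-- Truncation keeps the uniform structure and hence the completion, but makes all distances finite,
so that the metric results above apply to `LTop ℓ` itself. -/
theorem exists_homeomorph_lTop_etop (hpos : ∀ e, 0 < ℓ e) (hsum : Summable ℓ) :
    ∃ f : LTop ℓ ≃ₜ Etop G, ∀ x, f (toLTop ℓ x) = toEtop x := by
  let : PseudoMetricSpace (IdSpace ℓ) := truncatedPseudoMetric (IdSpace ℓ)
  have hdist : ∀ x y, dist (toLTop ℓ x) (toLTop ℓ y) = (min (lengthDist ℓ x y) 1).toReal :=
    fun x y => UniformSpace.Completion.dist_eq _ _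
  have hfin : ∀ r : ℝ≥0∞, min r 1 ≠ ∞ := fun r =>
    ((min_le_right _ _).trans_lt ENNReal.one_lt_top).ne
  have h : IsLengthEmbedding ℓ (toLTop ℓ) :=
    { denseRange := by
        have h1 : DenseRange ((↑) : IdSpace ℓ → LTop ℓ) := UniformSpace.Completion.denseRange_coe
        have h2 : DenseRange (SeparationQuotient.mk : LengthSpace ℓ → IdSpace ℓ) :=
          SeparationQuotient.surjective_mk.denseRange
        have h3 := h1.comp h2 (UniformSpace.Completion.continuous_coe _)
        exact h3
      dist_le := fun {x y r} hr => by
        rw [hdist]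
        refine ENNReal.toReal_le_of_le_ofReal hr.nonneg ?_
        exact (min_le_left _ _).trans (iInf₂_le r hr)
      le_dist := fun {x y δ} hδ hle => by
        rw [hdist, ← ENNReal.ofReal_le_iff_le_toReal (hfin _)]
        refine le_min (le_iInf₂ fun r hr => ENNReal.ofReal_le_ofReal (hle r hr)) ?_
        simpa using ENNReal.ofReal_le_ofReal hδ }
  exact h.exists_homeomorph_etop hpos hsum

end Completion

/-! ### Vertex cuts versus edge cuts -/

section VertexCuts

open Filter Topology

variable {G : SimpleGraph V}

/-- The edges of `G` that have an endvertex in `S`. -/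
def incidentEdges (G : SimpleGraph V) (S : Set V) : Set (Sym2 V) :=
  {e | e ∈ G.edgeSet ∧ ∃ v ∈ S, v ∈ e}

theorem incidentEdges_subset (S : Set V) : incidentEdges G S ⊆ G.edgeSet := fun _ h => h.1

theorem mem_incidentEdges {S : Set V} {e : G.edgeSet} :
    (e : Sym2 V) ∈ incidentEdges G S ↔ src e ∈ S ∨ tgt e ∈ S := by
  constructor
  · rintro ⟨-, v, hv, hve⟩
    rw [← mk_src_tgt e] at hve
    rcases Sym2.mem_iff.1 hve with rfl | rfl
    · exact Or.inl hv
    · exact Or.inr hv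
  · rintro (h | h)
    · exact ⟨e.2, _, h, mk_src_tgt e ▸ Sym2.mem_mk_left _ _⟩
    · exact ⟨e.2, _, h, mk_src_tgt e ▸ Sym2.mem_mk_right _ _⟩

theorem finite_incidentEdges (hloc : ∀ v : V, (G.neighborSet v).Finite) {S : Set V}
    (hS : S.Finite) : (incidentEdges G S).Finite := by
  refine (hS.biUnion fun v _ => (hloc v).image fun w => s(v, w)).subset ?_
  rintro e ⟨he, v, hv, hve⟩
  obtain ⟨w, rfl⟩ := Sym2.mem_iff_exists.1 hve
  exact Set.mem_biUnion hv ⟨w, he, rfl⟩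

theorem finite_endvertices {E : Set (Sym2 V)} (hE : E.Finite) :
    {v | ∃ e ∈ E, v ∈ e}.Finite := by
  have : {v | ∃ e ∈ E, v ∈ e} = ⋃ e ∈ E, {v | v ∈ e} := by
    ext v
    simp
  rw [this]
  refine hE.biUnion fun e _ => ?_
  induction e using Sym2.ind with
  | _ x y =>
    refine (Set.toFinite {x, y}).subset fun v hv => ?_
    simpa using hv

theorem ComponentCompl.eq_of_mem {S : Set V} {C D : G.ComponentCompl S} {v : V} (hC : v ∈ C)
    (hD : v ∈ D) : C = D := by
  obtain ⟨_, hC⟩ := hC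
  obtain ⟨_, hD⟩ := hD
  rw [← hC, ← hD]

/-- A walk that avoids `S` uses no edge of `E`. This is used both when `E` consists of the edges at
`S` and when `S` consists of the endvertices of `E`. -/
theorem ComponentCompl.reachable_deleteEdges {S : Set V} {E : Set (Sym2 V)}
    (hE : ∀ e ∈ E, ∃ v ∈ S, v ∈ e) {C : G.ComponentCompl S} {v w : V} (hv : v ∈ C)
    (hw : w ∈ C) : (G.deleteEdges E).Reachable v w := by
  obtain ⟨hvS, hv⟩ := hv
  obtain ⟨hwS, hw⟩ := hw
  have h : (G.induce Sᶜ).Reachable ⟨v, hvS⟩ ⟨w, hwS⟩ :=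
    SimpleGraph.ConnectedComponent.exact (hv.trans hw.symm)
  let f : G.induce Sᶜ →g G.deleteEdges E :=
    { toFun := Subtype.val
      map_rel' := fun {x y} hxy => SimpleGraph.deleteEdges_adj.2 ⟨hxy, fun hmem => by
        obtain ⟨u, huS, hu⟩ := hE _ hmem
        rcases Sym2.mem_iff.1 hu with rfl | rfl
        · exact x.2 huS
        · exact y.2 huS⟩ }
  exact h.map f

theorem ComponentCompl.mem_of_reachable {S : Set V} {C : G.ComponentCompl S} {v w : V}
    (hv : v ∈ C) (h : (G.deleteEdges (incidentEdges G S)).Reachable v w) : w ∈ C := by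
  obtain ⟨p⟩ := h
  induction p with
  | nil => exact hv
  | @cons u v w h p ih =>
    rw [SimpleGraph.deleteEdges_adj] at h
    refine ih (SimpleGraph.ComponentCompl.mem_of_adj _ _ hv (fun hvS => ?_) h.1)
    exact h.2 ⟨h.1, v, hvS, Sym2.mem_mk_right _ _⟩

/-- A component of `G - S`, for a set `S` of vertices, is also a component of the graph obtained
by deleting the edges at `S`. -/
theorem ComponentCompl.exists_supp_eq {S : Set V} (C : G.ComponentCompl S) :
    ∃ D : (G.deleteEdges (incidentEdges G S)).ConnectedComponent, ∀ v, v ∈ D.supp ↔ v ∈ C := by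
  obtain ⟨v, hv⟩ := C.nonempty
  refine ⟨SimpleGraph.connectedComponentMk _ v, fun w => ⟨fun hw => ?_, fun hw => ?_⟩⟩
  · exact ComponentCompl.mem_of_reachable hv (SimpleGraph.ConnectedComponent.exact hw).symm
  · exact SimpleGraph.ConnectedComponent.sound
      (ComponentCompl.reachable_deleteEdges (fun e he => he.2) hw hv)

/-- Deleting the endvertices of a finite edge set separates at least as much as deleting the edges.
-/
theorem EdgeEquiv.of_vertexEquiv {R L : Ray G} (h : VertexEquiv R L) : EdgeEquiv R L := by
  intro E hE _
  obtain ⟨C, hR, hL⟩ := h _ (finite_endvertices hE)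
  obtain ⟨v, hv⟩ := C.nonempty
  have key : ∀ w ∈ C, w ∈ (SimpleGraph.connectedComponentMk (G.deleteEdges E) v).supp :=
    fun w hw => SimpleGraph.ConnectedComponent.sound
      (ComponentCompl.reachable_deleteEdges (S := {v | ∃ e ∈ E, v ∈ e})
        (fun e he => ⟨_, ⟨e, he, Sym2.out_fst_mem e⟩, Sym2.out_fst_mem e⟩) hw hv)
  exact ⟨_, hR.mono fun n => key _, hL.mono fun n => key _⟩

theorem VertexEquiv.of_edgeEquiv (hloc : ∀ v : V, (G.neighborSet v).Finite) {R L : Ray G}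
    (h : EdgeEquiv R L) : VertexEquiv R L := by
  intro S hS
  obtain ⟨D, hR, hL⟩ := h _ (finite_incidentEdges hloc hS) (incidentEdges_subset S)
  -- Reflexivity is used only to obtain the component of `G - S` that contains a tail of `R`.
  obtain ⟨C, hC, -⟩ := VertexEquiv.refl R S hS
  obtain ⟨n, hnC, hnD⟩ := (hC.and hR).exists
  refine ⟨C, hC, hL.mono fun m hm => ?_⟩
  rw [SimpleGraph.ConnectedComponent.mem_supp_iff] at hm hnD
  exact ComponentCompl.mem_of_reachable hnC
    (SimpleGraph.ConnectedComponent.exact (hnD.trans hm.symm))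

/-- The edge-end that contains a given end. -/
def VertexEnd.toEdgeEnd : VertexEnd G → EdgeEnd G :=
  Quotient.lift (fun R => Quotient.mk (edgeSetoid G) R)
    fun _ _ h => Quotient.sound (EdgeEquiv.of_vertexEquiv h)

theorem VertexEnd.toEdgeEnd_injective (hloc : ∀ v : V, (G.neighborSet v).Finite) :
    Function.Injective (VertexEnd.toEdgeEnd (G := G)) := by
  refine Quotient.ind fun R => Quotient.ind fun L h => ?_
  exact Quotient.sound (VertexEquiv.of_edgeEquiv hloc (Quotient.exact h))

end VertexCuts

/-! ### Comparison of the Freudenthal compactification with `ETOP(G)` -/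

namespace Freudenthal

open Filter Topology

variable {G : SimpleGraph V}

/-- The canonical map from the Freudenthal compactification to `ETOP'(G)`. -/
def toEtopPre : Freudenthal G → EtopPre G
  | .point x => .point x
  | .vertexEnd ω => .edgeEnd ω.toEdgeEnd

theorem toEtopPre_surjective : Function.Surjective (toEtopPre (G := G)) := by
  rintro (x | ω)
  · exact ⟨.point x, rfl⟩
  · obtain ⟨R, rfl⟩ := Quotient.exists_rep ω
    exact ⟨.vertexEnd (Quotient.mk _ R), rfl⟩

/-- The basic open set of `|G|` given by a component `C` of `G - S`. -/
def compNhd (S : Set V) (C : G.ComponentCompl S) (a b : G.edgeSet → Set.Ioo (0 : ℝ) 1) :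
    Set (Freudenthal G) :=
  Freudenthal.point '' vertexCompPoints S C ∪ Freudenthal.vertexEnd '' vertexCompEnds S C ∪
    Freudenthal.point '' vertexCompHalfEdges S C a b

/-- The basic open set of `|G|` given by an open star. -/
def starNhd (v : V) (a b : G.edgeSet → Set.Ioo (0 : ℝ) 1) : Set (Freudenthal G) :=
  Freudenthal.point '' openStar v a b

theorem isOpen_compNhd {S : Set V} (hS : S.Finite) (C : G.ComponentCompl S)
    (a b : G.edgeSet → Set.Ioo (0 : ℝ) 1) : IsOpen (compNhd S C a b) :=
  TopologicalSpace.isOpen_generateFrom_of_mem (Or.inr ⟨S, C, a, b, hS, rfl⟩)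

theorem isOpen_starNhd (v : V) (a b : G.edgeSet → Set.Ioo (0 : ℝ) 1) :
    IsOpen (starNhd v a b) :=
  TopologicalSpace.isOpen_generateFrom_of_mem (Or.inl (Or.inr ⟨v, a, b, rfl⟩))

theorem isOpen_image_inner (e : G.edgeSet) {U : Set (Set.Ioo (0 : ℝ) 1)} (hU : IsOpen U) :
    IsOpen ((fun t => Freudenthal.point (.inner e t)) '' U) :=
  TopologicalSpace.isOpen_generateFrom_of_mem (Or.inl (Or.inl ⟨e, U, hU, rfl⟩))

section Membership

variable {S : Set V} {C : G.ComponentCompl S} {v w : V} {a b : G.edgeSet → Set.Ioo (0 : ℝ) 1}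

@[simp]
theorem vertex_mem_compNhd : Freudenthal.point (.vertex v) ∈ compNhd S C a b ↔ v ∈ C := by
  simp [compNhd, vertexCompPoints, vertexCompHalfEdges]

@[simp]
theorem vertexEnd_mem_compNhd {ω : VertexEnd G} :
    Freudenthal.vertexEnd ω ∈ compNhd S C a b ↔ ω ∈ vertexCompEnds S C := by
  simp [compNhd]

theorem inner_mem_compNhd {e : G.edgeSet} {t : Set.Ioo (0 : ℝ) 1} :
    Freudenthal.point (.inner e t) ∈ compNhd S C a b ↔ (src e ∈ C ∧ tgt e ∈ C) ∨
      (src e ∈ C ∧ tgt e ∈ S ∧ t < a e) ∨ (tgt e ∈ C ∧ src e ∈ S ∧ b e < t) := by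
  constructor
  · rintro ((⟨_, ⟨v, -, rfl⟩ | ⟨e', t', h1, h2, rfl⟩, heq⟩ | ⟨_, -, heq⟩) |
      ⟨_, ⟨e', t', h1, rfl⟩, heq⟩)
    · cases heq
    · cases heq
      exact Or.inl ⟨h1, h2⟩
    · cases heq
    · cases heq
      exact Or.inr h1
  · rintro (⟨h1, h2⟩ | h)
    · exact Or.inl (Or.inl ⟨_, Or.inr ⟨e, t, h1, h2, rfl⟩, rfl⟩)
    · exact Or.inr ⟨_, ⟨e, t, h, rfl⟩, rfl⟩

@[simp]
theorem vertex_mem_starNhd : Freudenthal.point (.vertex w) ∈ starNhd v a b ↔ w = v := by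
  simp [starNhd, openStar]

@[simp]
theorem vertexEnd_notMem_starNhd {ω : VertexEnd G} :
    Freudenthal.vertexEnd ω ∉ starNhd v a b := by
  simp [starNhd]

theorem inner_mem_starNhd {e : G.edgeSet} {t : Set.Ioo (0 : ℝ) 1} :
    Freudenthal.point (.inner e t) ∈ starNhd v a b ↔
      (src e = v ∧ t < a e) ∨ (tgt e = v ∧ b e < t) := by
  constructor
  · rintro ⟨_, heq' | ⟨e', t', h, rfl⟩, heq⟩
    · rw [heq'] at heq
      cases heq
    · cases heq
      exact h
  · intro h
    exact ⟨_, Or.inr ⟨e, t, h, rfl⟩, rfl⟩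

end Membership

/-- A cut edge with an endvertex in `C` has its other endvertex in `S`, so the half-edges agree.
Local finiteness enters for the ends, through injectivity of `VertexEnd.toEdgeEnd`. -/
theorem preimage_edgeCompNhd_incidentEdges (hloc : ∀ v : V, (G.neighborSet v).Finite) {S : Set V}
    {C : G.ComponentCompl S} {D : (G.deleteEdges (incidentEdges G S)).ConnectedComponent}
    (hD : ∀ v, v ∈ D.supp ↔ v ∈ C) (a b : G.edgeSet → Set.Ioo (0 : ℝ) 1) :
    toEtopPre ⁻¹' edgeCompNhd (incidentEdges G S) D a b = compNhd S C a b := by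
  have hdisj : ∀ v ∈ C, v ∉ S := fun v hv => hv.1
  ext p
  rw [Set.mem_preimage]
  cases p with
  | point x =>
    cases x with
    | vertex v => simp [toEtopPre, hD]
    | inner e t =>
      change EtopPre.point (.inner e t) ∈ _ ↔ _
      rw [inner_mem_compNhd]
      have hs := hdisj (src e)
      have ht := hdisj (tgt e)
      by_cases he : (e : Sym2 V) ∈ incidentEdges G S
      · rw [inner_mem_edgeCompNhd_of_mem he, hD, hD]
        rw [mem_incidentEdges] at he
        tauto
      · have hiff := src_mem_iff_tgt_mem (C := D) he
        rw [inner_mem_edgeCompNhd_of_notMem he, hD]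
        rw [hD, hD] at hiff
        rw [mem_incidentEdges] at he
        tauto
  | vertexEnd ω =>
    change EtopPre.edgeEnd ω.toEdgeEnd ∈ _ ↔ _
    rw [edgeEnd_mem_edgeCompNhd, vertexEnd_mem_compNhd]
    constructor
    · rintro ⟨R, hR, hRC⟩
      refine ⟨R, VertexEnd.toEdgeEnd_injective hloc hR, fun n => (hD _).1 (hRC n).1⟩
    · rintro ⟨R, rfl, hRC⟩
      refine ⟨R, rfl, fun n => ⟨(hD _).2 (hRC n), ?_⟩⟩
      rintro ⟨-, v, hvS, hv⟩
      rcases Sym2.mem_iff.1 hv with rfl | rfl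
      · exact hdisj _ (hRC _) hvS
      · exact hdisj _ (hRC _) hvS

/-- Cutting all edges at `v` isolates it, so its component contains no ray and every edge at `v`
contributes a half-edge. -/
theorem preimage_edgeCompNhd_singleton (v : V) (a b : G.edgeSet → Set.Ioo (0 : ℝ) 1) :
    toEtopPre ⁻¹' edgeCompNhd (incidentEdges G {v}) (SimpleGraph.connectedComponentMk _ v) a b =
      starNhd v a b := by
  have hsupp : ∀ w, w ∈ (SimpleGraph.connectedComponentMk
      (G.deleteEdges (incidentEdges G {v})) v).supp ↔ w = v := by
    intro w
    constructor
    · intro hw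
      obtain ⟨p⟩ := (SimpleGraph.ConnectedComponent.exact hw).symm
      cases p with
      | nil => rfl
      | cons h p =>
        rw [SimpleGraph.deleteEdges_adj] at h
        exact absurd ⟨h.1, v, rfl, Sym2.mem_mk_left _ _⟩ h.2
    · rintro rfl
      rfl
  ext p
  rw [Set.mem_preimage]
  cases p with
  | point x =>
    cases x with
    | vertex w =>
      change EtopPre.point (.vertex w) ∈ _ ↔ _
      rw [vertex_mem_edgeCompNhd, hsupp, vertex_mem_starNhd]
    | inner e t =>
      change EtopPre.point (.inner e t) ∈ _ ↔ _
      rw [inner_mem_starNhd]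
      by_cases he : (e : Sym2 V) ∈ incidentEdges G {v}
      · rw [inner_mem_edgeCompNhd_of_mem he, hsupp, hsupp]
      · rw [inner_mem_edgeCompNhd_of_notMem he, hsupp]
        rw [mem_incidentEdges] at he
        simp only [Set.mem_singleton_iff] at he
        tauto
  | vertexEnd ω =>
    change EtopPre.edgeEnd ω.toEdgeEnd ∈ _ ↔ _
    rw [edgeEnd_mem_edgeCompNhd]
    refine iff_of_false ?_ vertexEnd_notMem_starNhd
    rintro ⟨R, -, hR⟩
    have h := ((hsupp _).1 (hR 0).1).trans ((hsupp _).1 (hR 1).1).symm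
    exact absurd (R.injective h) (by norm_num)

theorem continuous_toEtopPre (hloc : ∀ v : V, (G.neighborSet v).Finite) :
    Continuous (toEtopPre (G := G)) := by
  refine continuous_generateFrom_iff.2 ?_
  rintro _ (⟨e, U, hU, rfl⟩ | ⟨E, C, a, b, hE, -, rfl⟩)
  · convert isOpen_image_inner e hU using 1
    ext p
    cases p <;> simp [toEtopPre]
  · change IsOpen (toEtopPre ⁻¹' edgeCompNhd E C a b)
    rw [isOpen_iff_forall_mem_open]
    intro p hp
    rw [Set.mem_preimage] at hp
    cases p with
    | point x =>
      cases x with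
      | vertex v =>
        have hv : v ∈ C.supp := vertex_mem_edgeCompNhd.1 hp
        refine ⟨starNhd v a b, ?_, isOpen_starNhd v a b, vertex_mem_starNhd.2 rfl⟩
        rintro (x | ω) hq
        · cases x with
          | vertex w =>
            rw [vertex_mem_starNhd] at hq
            subst hq
            exact hp
          | inner e t =>
            rw [inner_mem_starNhd] at hq
            change EtopPre.point (.inner e t) ∈ edgeCompNhd E C a b
            by_cases he : (e : Sym2 V) ∈ E
            · rw [inner_mem_edgeCompNhd_of_mem he]
              rcases hq with ⟨rfl, h⟩ | ⟨rfl, h⟩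
              · exact Or.inl ⟨hv, h⟩
              · exact Or.inr ⟨hv, h⟩
            · rw [inner_mem_edgeCompNhd_of_notMem he]
              rcases hq with ⟨rfl, h⟩ | ⟨rfl, h⟩
              · exact hv
              · exact (src_mem_iff_tgt_mem he).2 hv
        · exact absurd hq vertexEnd_notMem_starNhd
      | inner e t =>
        obtain ⟨U, hU, htU, hsub⟩ := exists_isOpen_inner_subset hp
        refine ⟨_, ?_, isOpen_image_inner e hU, t, htU, rfl⟩
        rintro _ ⟨s, hs, rfl⟩
        exact hsub ⟨s, hs, rfl⟩
    | vertexEnd ω =>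
      obtain ⟨R, hR, hRC⟩ := edgeEnd_mem_edgeCompNhd.1 hp
      have hω : Quotient.mk (vertexSetoid G) R = ω := VertexEnd.toEdgeEnd_injective hloc hR
      subst hω
      -- With all endvertices of `E` deleted, the component `D` that contains a tail of `R` lies
      -- inside `C`.
      let S : Set V := {v | ∃ e ∈ E, v ∈ e}
      have hS : S.Finite := finite_endvertices hE
      have hSE : ∀ e ∈ E, ∃ v ∈ S, v ∈ e := fun e he =>
        ⟨_, ⟨e, he, Sym2.out_fst_mem e⟩, Sym2.out_fst_mem e⟩
      obtain ⟨D, hD, -⟩ := VertexEquiv.refl R S hS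
      obtain ⟨n, hn⟩ := hD.exists
      have hDC : ∀ w ∈ D, w ∈ C.supp := fun w hw =>
        (SimpleGraph.ConnectedComponent.sound
          (ComponentCompl.reachable_deleteEdges hSE hw hn)).trans (hRC n).1
      refine ⟨compNhd S D a b, ?_, isOpen_compNhd hS D a b,
        vertexEnd_mem_compNhd.2 (mk_mem_vertexCompEnds R hD)⟩
      rintro (x | ω) hq
      · cases x with
        | vertex w => exact vertex_mem_edgeCompNhd.2 (hDC w (vertex_mem_compNhd.1 hq))
        | inner e t =>
          rw [inner_mem_compNhd] at hq
          change EtopPre.point (.inner e t) ∈ edgeCompNhd E C a b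
          by_cases he : (e : Sym2 V) ∈ E
          · rw [inner_mem_edgeCompNhd_of_mem he]
            rcases hq with ⟨h1, -⟩ | ⟨h1, -, h2⟩ | ⟨h1, -, h2⟩
            · refine absurd ⟨_, he, ?_⟩ h1.1
              rw [← mk_src_tgt e]
              exact Sym2.mem_mk_left _ _
            · exact Or.inl ⟨hDC _ h1, h2⟩
            · exact Or.inr ⟨hDC _ h1, h2⟩
          · rw [inner_mem_edgeCompNhd_of_notMem he]
            rcases hq with ⟨h1, -⟩ | ⟨h1, -⟩ | ⟨h1, -⟩
            · exact hDC _ h1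
            · exact hDC _ h1
            · exact (src_mem_iff_tgt_mem he).2 (hDC _ h1)
      · obtain ⟨L, rfl, hL⟩ := vertexEnd_mem_compNhd.1 hq
        exact edgeEnd_mem_edgeCompNhd.2
          (mk_mem_edgeCompEnds L hE (Eventually.of_forall fun n => hDC _ (hL n)))

theorem isInducing_toEtopPre (hloc : ∀ v : V, (G.neighborSet v).Finite) :
    IsInducing (toEtopPre (G := G)) := by
  refine ⟨le_antisymm (continuous_iff_le_induced.1 (continuous_toEtopPre hloc)) ?_⟩
  refine le_generateFrom ?_
  rintro _ ((⟨e, U, hU, rfl⟩ | ⟨v, a, b, rfl⟩) | ⟨S, C, a, b, hS, rfl⟩)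
  · refine isOpen_induced_iff.2 ⟨_, GraphSpace.isOpen_image_inner e hU, ?_⟩
    ext p
    cases p <;> simp [toEtopPre]
  · exact isOpen_induced_iff.2 ⟨_, isOpen_edgeCompNhd
      (finite_incidentEdges hloc (Set.finite_singleton v)) (incidentEdges_subset _) _ a b,
      preimage_edgeCompNhd_singleton v a b⟩
  · obtain ⟨D, hD⟩ := ComponentCompl.exists_supp_eq C
    exact isOpen_induced_iff.2 ⟨_, isOpen_edgeCompNhd (finite_incidentEdges hloc hS)
      (incidentEdges_subset _) D a b, preimage_edgeCompNhd_incidentEdges hloc hD a b⟩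

theorem eq_of_inseparable_inner {e : G.edgeSet} {t : Set.Ioo (0 : ℝ) 1} {q : Freudenthal G}
    (h : Inseparable (Freudenthal.point (.inner e t)) q) : Freudenthal.point (.inner e t) = q := by
  rw [inseparable_iff_forall_isOpen] at h
  obtain ⟨s, -, rfl⟩ := (h _ (isOpen_image_inner e isOpen_univ)).1 ⟨t, trivial, rfl⟩
  by_contra hne
  have hst : s ≠ t := fun hst => hne (by rw [hst])
  obtain ⟨r, hr, heq⟩ := (h _ (isOpen_image_inner e isOpen_compl_singleton)).2 ⟨s, hst, rfl⟩
  cases heq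
  exact hr rfl

theorem eq_of_inseparable_vertex {v : V} {q : Freudenthal G}
    (h : Inseparable (Freudenthal.point (.vertex v)) q) : Freudenthal.point (.vertex v) = q := by
  let a : G.edgeSet → Set.Ioo (0 : ℝ) 1 := fun _ => ⟨1 / 2, by norm_num, by norm_num⟩
  have hq := (inseparable_iff_forall_isOpen.1 h _ (isOpen_starNhd v a a)).1
    (vertex_mem_starNhd.2 rfl)
  rcases q with (w | ⟨e, t⟩) | ω
  · rw [vertex_mem_starNhd.1 hq]
  · exact (eq_of_inseparable_inner h.symm).symm
  · exact absurd hq vertexEnd_notMem_starNhd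

/-- Open subsets of edges single out inner points and stars single out vertices. Ends that share all
their basic neighbourhoods are vertex-equivalent by definition of the latter. -/
instance : T0Space (Freudenthal G) where
  t0 := by
    rintro ((v | ⟨e, t⟩) | ω) q h
    · exact eq_of_inseparable_vertex h
    · exact eq_of_inseparable_inner h
    · rcases q with (v | ⟨e, t⟩) | ω'
      · exact (eq_of_inseparable_vertex h.symm).symm
      · exact (eq_of_inseparable_inner h.symm).symm
      · obtain ⟨R, rfl⟩ := Quotient.exists_rep ω
        obtain ⟨L, rfl⟩ := Quotient.exists_rep ω'
        refine congrArg _ (Quotient.sound fun S hS => ?_)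
        let a : G.edgeSet → Set.Ioo (0 : ℝ) 1 := fun _ => ⟨1 / 2, by norm_num, by norm_num⟩
        obtain ⟨C, hC, -⟩ := VertexEquiv.refl R S hS
        have hL := (inseparable_iff_forall_isOpen.1 h _ (isOpen_compNhd hS C a a)).1
          (vertexEnd_mem_compNhd.2 (mk_mem_vertexCompEnds R hC))
        obtain ⟨L', hL', hLC⟩ := vertexEnd_mem_compNhd.1 hL
        obtain ⟨D, hD', hD⟩ := (Quotient.exact hL' : VertexEquiv L' L) S hS
        obtain ⟨n, hn⟩ := hD'.exists
        have hCD : C = D := ComponentCompl.eq_of_mem (hLC n) hn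
        subst hCD
        exact ⟨C, hC, hD⟩

/-- An inducing map from a T0 space is injective; in particular, for locally finite `G`, no two
points of `ETOP'(G)` are identified. -/
theorem exists_homeomorph_etop (hloc : ∀ v : V, (G.neighborSet v).Finite) :
    ∃ f : Freudenthal G ≃ₜ Etop G, ∀ x, f (.point x) = toEtop x := by
  have hind : IsInducing (SeparationQuotient.mk ∘ toEtopPre (G := G)) :=
    SeparationQuotient.isInducing_mk.comp (isInducing_toEtopPre hloc)
  have hsurj : Function.Surjective (SeparationQuotient.mk ∘ toEtopPre (G := G)) :=
    SeparationQuotient.surjective_mk.comp toEtopPre_surjective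
  exact ⟨(Equiv.ofBijective _ ⟨hind.injective, hsurj⟩).toHomeomorphOfIsInducing hind,
    fun _ => rfl⟩

end Freudenthal

end GraphSpace

theorem mainTheorem1 {V : Type*} (G : SimpleGraph V) (ℓ : G.edgeSet → ℝ≥0)
    (hpos : ∀ e, 0 < ℓ e) (hsum : Summable ℓ) :
    (Countable V →
      ∃ h : GraphSpace.LTop ℓ ≃ₜ GraphSpace.Etop G,
        ∀ x : GraphSpace.OneComplex G, h (GraphSpace.toLTop ℓ x) = GraphSpace.toEtop x) ∧
    ((∀ v : V, (G.neighborSet v).Finite) →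
      ∃ h : GraphSpace.LTop ℓ ≃ₜ GraphSpace.Freudenthal G,
        ∀ x : GraphSpace.OneComplex G,
          h (GraphSpace.toLTop ℓ x) = GraphSpace.Freudenthal.point x) := by
  obtain ⟨f, hf⟩ := GraphSpace.exists_homeomorph_lTop_etop hpos hsum
  refine ⟨fun _ => ⟨f, hf⟩, fun hloc => ?_⟩
  obtain ⟨g, hg⟩ := GraphSpace.Freudenthal.exists_homeomorph_etop hloc
  refine ⟨f.trans g.symm, fun x => ?_⟩
  rw [Homeomorph.trans_apply, hf, Homeomorph.symm_apply_eq, hg]
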